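/- Let $m,n\ge 1$. Write $|\cdot|$ for the supremum norm and $\|\mathbf y\|$ for the supremum-norm distance from $\mathbf y\in\mathbb R^m$ to the nearest integer point; let $\langle \mathbf y\rangle$ be the point of $[-1/2,1/2)^m$ congruent to $\mathbf y$ modulo $\mathbb Z^m$, $\prod \mathbf y=\prod_{j=1}^m|y_j|$ and $\prod_+(\mathbf q)=\prod_{i=1}^n\max\{1,|q_i|\}$. For $X\in\mathbb R^{m\times n}$ and $\theta\in\mathbb R^m$ let $w(X,\theta)\in[0,\infty]$ be the supremum of the $w\ge 0$ such that for arbitrarily large $Q>1$ there is $\mathbf q\in\mathbb Z^n\setminus\{0\}$ with $$\|X\mathbf q+\theta\|^m<Q^{-w}\quad\text{and}\quad |\mathbf q|^n\le Q,$$ and let $w^*(X,\theta)\in[0,\infty]$ be the supremum of the $w\ge 0$ such that for arbitrarily large $Q>1$ there is $\mathbf q\in\mathbb Z^n\setminus\{0\}$ with $$\textstyle\prod\langle X\mathbf q+\theta\rangle<Q^{-w}\quad\text{and}\quad \prod_+(\mathbf q)\le Q.$$ A Borel measure $\mu$ on $\mathbb R^{m\times n}$ is \emph{extremal} if $w(X,0)=1$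 for $\mu$-a.e. $X$, and \emph{inhomogeneously extremal} if for every $\theta\in\mathbb R^m$, $w(X,\theta)=1$ for $\mu$-a.e. $X$. It is \emph{strongly extremal}, respectively \emph{inhomogeneously strongly extremal}, if the same holds with $w^*$ in place of $w$. For $\mathbf a\in\mathbb R^n$ with Euclidean norm $1$, $\mathbf b\in\mathbb R^m$ and $\varepsilon\in(0,\infty)^m$ put $$\mathcal L^{(\varepsilon)}_{\mathbf a,\mathbf b}=\{X\in\mathbb R^{m\times n}: |X_j\mathbf a+b_j|<\varepsilon_j,\ 1\le j\le m\},$$ where $X_j$ is the $j$-th row of $X$. Balls in $\mathbb R^{m\times n}$ are taken in the Euclidean metric, $cB$ is the ball with the centre of $B$ and $c$ times its radius, and $\mathbf S$ is the support of $\mu$. A Borel measure $\mu$ is \emph{strongly contracting} if it is non-atomic (every point has measure zero), finite, doubling (there is $\lambda>1$ with $\mu(2B)\le\lambda\mu(B)$ for every ball $B$ centred in $\mathbf S$), and there are $C,\alpha,r_0>0$ such that for all such $\mathbf a,\mathbf b$, all $\varepsilon\in(0,\infty)^m$ with $\min_j\varepsilon_j<r_0$, all $\delta\in(0,1)$ and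 all $X\in\mathcal L^{(\delta\varepsilon)}_{\mathbf a,\mathbf b}\cap\mathbf S$ there is an open ball $B$ centred at $X$ with $$B\cap\mathbf S\subset\mathcal L^{(\varepsilon)}_{\mathbf a,\mathbf b}\quad\text{and}\quad \mu\big(5B\cap\mathcal L^{(\delta\varepsilon)}_{\mathbf a,\mathbf b}\big)\le C\delta^\alpha\mu(5B).$$ It is \emph{contracting} if the same holds with the last requirement restricted to $\varepsilon_1=\dots=\varepsilon_m$. It is \emph{(strongly) contracting almost everywhere} if $\mu$-a.e. $X_0$ has a neighbourhood $U$ such that the restriction $\mu|_U$ is (strongly) contracting. \textbf{Theorem.} Let $\mu$ be a Borel measure on $\mathbb R^{m\times n}$. (A) If $\mu$ is contracting almost everywhere, then $\mu$ is extremal if and only if $\mu$ is inhomogeneously extremal. (B) If $\mu$ is strongly contracting almost everywhere, then $\mu$ is strongly extremal if and only if $\mu$ is inhomogeneously strongly extremal. -/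

import Mathlib

open MeasureTheory Topology Filter
open scoped ENNReal NNReal

noncomputable section

namespace InhomDioph

/-- The space of real `m × n` matrices, with the Euclidean metric and its Borel `σ`-algebra.
The entry of `X` in row `j` and column `i` is `X (j, i)`. -/
abbrev MatSpace (m n : ℕ) : Type := EuclideanSpace ℝ (Fin m × Fin n)

/-- The affine forms `X q + θ`, for an integer column `q`. -/
def affineForm {m n : ℕ} (X : MatSpace m n) (q : Fin n → ℤ) (θ : Fin m → ℝ) : Fin m → ℝ :=
  fun j => (∑ i, X (j, i) * (q i : ℝ)) + θ j

/-- Distance of `y ∈ ℝ^m` to the nearest integer point, in the supremum norm. -/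
def distInt {m : ℕ} (y : Fin m → ℝ) : ℝ := ‖fun j => y j - (round (y j) : ℝ)‖

/-- The product over the coordinates of `y` of their distances to the nearest integer. -/
def prodDistInt {m : ℕ} (y : Fin m → ℝ) : ℝ := ∏ j, |y j - (round (y j) : ℝ)|

/-- The product `∏ max (1, |q_i|)`. -/
def prodPlus {n : ℕ} (q : Fin n → ℤ) : ℝ := ∏ i, max 1 |(q i : ℝ)|

/-- `‖X q + θ‖ ^ m < Q ^ (-w)` and `|q| ^ n ≤ Q` are solvable in nonzero integer vectors `q`
for arbitrarily large `Q > 1`. -/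
def Approximable {m n : ℕ} (X : MatSpace m n) (θ : Fin m → ℝ) (w : ℝ≥0) : Prop :=
  ∀ Q₀ : ℝ, ∃ Q : ℝ, Q₀ < Q ∧ 1 < Q ∧ ∃ q : Fin n → ℤ, q ≠ 0 ∧
    distInt (affineForm X q θ) ^ m < Q ^ (-(w : ℝ)) ∧ ‖fun i => (q i : ℝ)‖ ^ n ≤ Q

/-- The multiplicative version: `∏ |⟨X q + θ⟩| < Q ^ (-w)` and `∏ max (1, |q_i|) ≤ Q`. -/
def MulApproximable {m n : ℕ} (X : MatSpace m n) (θ : Fin m → ℝ) (w : ℝ≥0) : Prop :=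
  ∀ Q₀ : ℝ, ∃ Q : ℝ, Q₀ < Q ∧ 1 < Q ∧ ∃ q : Fin n → ℤ, q ≠ 0 ∧
    prodDistInt (affineForm X q θ) < Q ^ (-(w : ℝ)) ∧ prodPlus q ≤ Q

/-- The Diophantine exponent `w(X, θ) ∈ [0, ∞]`. -/
def exponent {m n : ℕ} (X : MatSpace m n) (θ : Fin m → ℝ) : ℝ≥0∞ :=
  ⨆ (w : ℝ≥0) (_ : Approximable X θ w), (w : ℝ≥0∞)

/-- The multiplicative Diophantine exponent `w*(X, θ) ∈ [0, ∞]`. -/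
def mulExponent {m n : ℕ} (X : MatSpace m n) (θ : Fin m → ℝ) : ℝ≥0∞ :=
  ⨆ (w : ℝ≥0) (_ : MulApproximable X θ w), (w : ℝ≥0∞)

/-- `μ` is extremal: `w(X, 0) = 1` for `μ`-almost every `X`. -/
def Extremal {m n : ℕ} (μ : Measure (MatSpace m n)) : Prop :=
  ∀ᵐ X ∂μ, exponent X 0 = 1

/-- `μ` is strongly extremal: `w*(X, 0) = 1` for `μ`-almost every `X`. -/
def StronglyExtremal {m n : ℕ} (μ : Measure (MatSpace m n)) : Prop :=
  ∀ᵐ X ∂μ, mulExponent X 0 = 1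

/-- `μ` is inhomogeneously extremal. -/
def InhomExtremal {m n : ℕ} (μ : Measure (MatSpace m n)) : Prop :=
  ∀ θ : Fin m → ℝ, ∀ᵐ X ∂μ, exponent X θ = 1

/-- `μ` is inhomogeneously strongly extremal. -/
def InhomStronglyExtremal {m n : ℕ} (μ : Measure (MatSpace m n)) : Prop :=
  ∀ θ : Fin m → ℝ, ∀ᵐ X ∂μ, mulExponent X θ = 1

/-- The `ε`-neighbourhood of the plane `{X | X a + b = 0}`, with one width for each row. -/
def planeNhd {m n : ℕ} (a : Fin n → ℝ) (b ε : Fin m → ℝ) : Set (MatSpace m n) :=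
  {X | ∀ j, |(∑ i, X (j, i) * a i) + b j| < ε j}

/-- `μ` is doubling: `μ (2B) ≤ L μ (B)` for all balls `B` centred in the support of `μ`. -/
def IsDoubling {m n : ℕ} (μ : Measure (MatSpace m n)) : Prop :=
  ∃ L : ℝ≥0, 1 < L ∧ ∀ X ∈ μ.support, ∀ r : ℝ, 0 < r →
    μ (Metric.ball X (2 * r)) ≤ L * μ (Metric.ball X r)

/-- The decay condition at the plane `{X | X a + b = 0}`, for the widths `ε` and the contraction
factor `δ`, with constants `C` and `α`. -/
def DecayAt {m n : ℕ} (μ : Measure (MatSpace m n)) (C α : ℝ) (a : Fin n → ℝ)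
    (b ε : Fin m → ℝ) (δ : ℝ) : Prop :=
  ∀ X ∈ planeNhd a b (δ • ε) ∩ μ.support, ∃ r : ℝ, 0 < r ∧
    Metric.ball X r ∩ μ.support ⊆ planeNhd a b ε ∧
    μ (Metric.ball X (5 * r) ∩ planeNhd a b (δ • ε)) ≤
      ENNReal.ofReal (C * δ ^ α) * μ (Metric.ball X (5 * r))

/-- Strongly contracting measures: non-atomic, finite, doubling, and with the decay condition
for all planes and all tuples of widths whose minimum is less than `r₀`. -/
structure StronglyContracting {m n : ℕ} (μ : Measure (MatSpace m n)) : Prop where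
  nonatomic : ∀ X, μ {X} = 0
  finite : IsFiniteMeasure μ
  doubling : IsDoubling μ
  decay : ∃ C α r₀ : ℝ, 0 < C ∧ 0 < α ∧ 0 < r₀ ∧
    ∀ (a : Fin n → ℝ) (b : Fin m → ℝ), ∑ i, a i ^ 2 = 1 →
      ∀ ε : Fin m → ℝ, (∀ j, 0 < ε j) → (∃ j, ε j < r₀) →
        ∀ δ : ℝ, 0 < δ → δ < 1 → DecayAt μ C α a b ε δ

/-- Contracting measures: the same with the decay condition only for equal widths. -/
structure Contracting {m n : ℕ} (μ : Measure (MatSpace m n)) : Prop where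
  nonatomic : ∀ X, μ {X} = 0
  finite : IsFiniteMeasure μ
  doubling : IsDoubling μ
  decay : ∃ C α r₀ : ℝ, 0 < C ∧ 0 < α ∧ 0 < r₀ ∧
    ∀ (a : Fin n → ℝ) (b : Fin m → ℝ), ∑ i, a i ^ 2 = 1 →
      ∀ ε : ℝ, 0 < ε → ε < r₀ →
        ∀ δ : ℝ, 0 < δ → δ < 1 → DecayAt μ C α a b (fun _ => ε) δ

/-- Almost every point has a neighbourhood on which the restriction of `μ` is contracting. -/
def ContractingAE {m n : ℕ} (μ : Measure (MatSpace m n)) : Prop :=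
  ∀ᵐ X₀ ∂μ, ∃ U ∈ 𝓝 X₀, Contracting (μ.restrict U)

/-- Almost every point has a neighbourhood on which the restriction of `μ` is strongly
contracting. -/
def StronglyContractingAE {m n : ℕ} (μ : Measure (MatSpace m n)) : Prop :=
  ∀ᵐ X₀ ∂μ, ∃ U ∈ 𝓝 X₀, StronglyContracting (μ.restrict U)

end InhomDioph

end

/-! Taking `θ = 0` gives one direction; the other splits into two bounds on the inhomogeneous
exponents.

Lower bound, valid for each `X` with `w(X, 0) ≤ 1`. If the homogeneous system has no unusually small
values in a box, the lattice of points `(X q + p, q)`, rescaled, has no nonzero vector of norm less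
than one. A packing argument (`exists_int_norm_map_sub_lt`) then bounds its covering radius by the
determinant plus one, so every shift `θ` is approximated almost as well as expected
(`one_le_exponent`). The multiplicative case follows from `w ≤ w*`.

Upper bound, valid almost everywhere. Being too well approximable means lying, at infinitely many
dyadic scales, in a thin slab `|X q + θ + p| < ρ`. Each thin slab sits in a thick one of width `ρ /
κ`, with `κ` exponentially small in the scale, and the contracting property says that the thin slab
occupies a proportion `C κ ^ α` of suitable balls. If the thick slabs at one scale were disjoint, a
Vitali covering would bound the total mass of the thin ones by a multiple of `κ ^ α`, and
Borel–Cantelli would finish. They may overlap, but subtracting two inhomogeneous inequalities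
removes `θ`: a point of an overlap is too well approximable in the homogeneous sense, which happens
almost surely at finitely many scales only. By a weak-type maximal estimate, almost every point is
also the centre of balls half filled by overlaps at finitely many scales only, so such balls can be
ignored. This is `ae_finite_thin`, specialised to slabs in `ae_finite_slab`.

In the multiplicative case each scale is cut into dyadic boxes recording the sizes of the
coordinates. Their number is polynomial in the scale, so the exponential gain survives. -/

namespace InhomDioph

/-! ### Doubling measures, Vitali coverings and abstract inhomogeneous transference. -/

section Covering

/-- Vitali's covering lemma for families of balls of bounded radius, one at each point of a set. -/
lemma exists_countable_disjoint_balls {E : Type*} [MetricSpace E] [SecondCountableTopology E]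
    (A : Set E) (r : E → ℝ) (R : ℝ)
    (hr : ∀ x ∈ A, 0 < r x) (hR : ∀ x ∈ A, r x ≤ R) :
    ∃ u ⊆ A, u.Countable ∧ u.PairwiseDisjoint (fun x => Metric.ball x (r x)) ∧
      A ⊆ ⋃ x ∈ u, Metric.ball x (5 * r x) := by
  obtain ⟨u, huA, hdisj, hcov⟩ := Vitali.exists_disjoint_subfamily_covering_enlargement_closedBall
    A (fun x => x) r R hR 4 (by norm_num)
  have hd : u.PairwiseDisjoint (fun x => Metric.ball x (r x)) := fun x hx y hy hxy =>
    (hdisj hx hy hxy).mono Metric.ball_subset_closedBall Metric.ball_subset_closedBall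
  refine ⟨u, huA, ?_, hd, ?_⟩
  · exact hd.countable_of_isOpen (fun x _ => Metric.isOpen_ball)
      (fun x hx => ⟨x, Metric.mem_ball_self (hr x (huA hx))⟩)
  · intro x hx
    obtain ⟨y, hy, hsub⟩ := hcov x hx
    have h1 : x ∈ Metric.closedBall y (4 * r y) :=
      hsub (Metric.mem_closedBall_self (hr x hx).le)
    have h2 := hr y (huA hy)
    simp only [Set.mem_iUnion, exists_prop]
    exact ⟨y, hy, Metric.closedBall_subset_ball (by linarith) h1⟩

lemma measure_ball_five_mul_le {E : Type*} [MetricSpace E] [MeasurableSpace E]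
    {μ : Measure E} {L : ℝ≥0}
    (hL : ∀ x ∈ μ.support, ∀ r : ℝ, 0 < r → μ (Metric.ball x (2 * r)) ≤ L * μ (Metric.ball x r))
    {x : E} (hx : x ∈ μ.support) {r : ℝ} (hr : 0 < r) :
    μ (Metric.ball x (5 * r)) ≤ (L : ℝ≥0∞) ^ 3 * μ (Metric.ball x r) :=
  calc μ (Metric.ball x (5 * r)) ≤ μ (Metric.ball x (2 * (2 * (2 * r)))) :=
        measure_mono (Metric.ball_subset_ball (by linarith))
    _ ≤ L * (L * (L * μ (Metric.ball x r))) := by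
        refine (hL x hx _ (by positivity)).trans ?_
        gcongr
        refine (hL x hx _ (by positivity)).trans ?_
        gcongr
        exact hL x hx _ hr
    _ = _ := by ring

lemma tendsto_measure_of_antitone {E : Type*} [MeasurableSpace E] {μ : Measure E}
    [IsFiniteMeasure μ] {s : ℕ → Set E}
    (hs : ∀ n, MeasurableSet (s n)) (ha : Antitone s) (h : μ (⋂ n, s n) = 0) :
    Tendsto (fun n => μ (s n)) atTop (𝓝 0) := by
  rw [← h]
  exact tendsto_measure_iInter_atTop (fun n => (hs n).nullMeasurableSet) ha
    ⟨0, measure_ne_top _ _⟩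

/-- A finite doubling measure has bounded support. -/
lemma isBounded_support_of_doubling {E : Type*} [MetricSpace E] [MeasurableSpace E] [BorelSpace E]
    {μ : Measure E} {L : ℝ≥0} [IsFiniteMeasure μ]
    (hL : ∀ x ∈ μ.support, ∀ r : ℝ, 0 < r → μ (Metric.ball x (2 * r)) ≤ L * μ (Metric.ball x r)) :
    Bornology.IsBounded μ.support := by
  rcases μ.support.eq_empty_or_nonempty with h0 | ⟨x₀, hx₀⟩
  · rw [h0]; exact Bornology.isBounded_empty
  have hc : 0 < μ (Metric.ball x₀ 1) :=
    (Measure.mem_support_iff_forall x₀).1 hx₀ _ (Metric.ball_mem_nhds _ one_pos)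
  have hlim : Tendsto (fun n : ℕ => (L : ℝ≥0∞) ^ 2 * μ (Metric.ball x₀ n)ᶜ) atTop (𝓝 0) := by
    have h1 := tendsto_measure_of_antitone (μ := μ) (s := fun n : ℕ => (Metric.ball x₀ (n : ℝ))ᶜ)
      (fun n => Metric.isOpen_ball.measurableSet.compl)
      (fun a b hab => Set.compl_subset_compl.2 (Metric.ball_subset_ball (by exact_mod_cast hab)))
      (by rw [← Set.compl_iUnion, Metric.iUnion_ball_nat]; simp)
    simpa using ENNReal.Tendsto.const_mul (a := (L : ℝ≥0∞) ^ 2) h1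
      (Or.inr (by simp))
  obtain ⟨n, hn⟩ := ((tendsto_order.1 hlim).2 _ hc).exists
  refine (Metric.isBounded_ball (x := x₀) (r := 2 * n + 1)).subset fun x hx => ?_
  by_contra hfar
  rw [Metric.mem_ball, not_lt] at hfar
  set d := dist x x₀ with hd
  have hn0 : (0 : ℝ) ≤ n := n.cast_nonneg
  -- The ball of radius `2d` about the far point `x` contains the unit ball about `x₀`, while the
  -- ball of radius `d / 2` avoids the ball of radius `n`. Doubling twice compares their masses.
  refine absurd hn (not_lt.2 ?_)
  calc μ (Metric.ball x₀ 1) ≤ μ (Metric.ball x (2 * (2 * (d / 2)))) := by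
        refine measure_mono fun y hy => ?_
        rw [Metric.mem_ball] at hy ⊢
        have := dist_triangle y x₀ x
        rw [dist_comm x₀ x] at this
        linarith
    _ ≤ L * (L * μ (Metric.ball x (d / 2))) := by
        refine (hL x hx _ (by linarith)).trans ?_
        gcongr
        exact hL x hx _ (by linarith)
    _ = (L : ℝ≥0∞) ^ 2 * μ (Metric.ball x (d / 2)) := by ring
    _ ≤ _ := by
        gcongr
        intro y hy hy'
        rw [Metric.mem_ball] at hy hy'
        have := dist_triangle x y x₀
        rw [dist_comm x y] at this
        linarith

variable {E : Type*} [MetricSpace E] [SecondCountableTopology E] [MeasurableSpace E] [BorelSpace E]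
  {μ : Measure E} {L : ℝ≥0}

/-- Weak-type estimate: the points that are centres of balls of which a set `M` fills more than
half form a set of measure at most a multiple of the measure of `M`. -/
lemma measure_centres_le
    (hL : ∀ x ∈ μ.support, ∀ r : ℝ, 0 < r → μ (Metric.ball x (2 * r)) ≤ L * μ (Metric.ball x r))
    {M : Set E} (hM : MeasurableSet M) (R : ℝ) :
    μ {x | x ∈ μ.support ∧ ∃ r, 0 < r ∧ r ≤ R ∧
      μ (Metric.ball x r) ≤ 2 * μ (Metric.ball x r ∩ M)} ≤ (L : ℝ≥0∞) ^ 3 * (2 * μ M) := by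
  set A := {x | x ∈ μ.support ∧ ∃ r, 0 < r ∧ r ≤ R ∧
      μ (Metric.ball x r) ≤ 2 * μ (Metric.ball x r ∩ M)} with hA
  have hex : ∀ x, ∃ r, x ∈ A → 0 < r ∧ r ≤ R ∧
      μ (Metric.ball x r) ≤ 2 * μ (Metric.ball x r ∩ M) := by
    intro x
    by_cases hx : x ∈ A
    · obtain ⟨r, hr⟩ := hx.2
      exact ⟨r, fun _ => hr⟩
    · exact ⟨0, fun h => absurd h hx⟩
  choose r hr using hex
  obtain ⟨u, huA, hc, hd, hcov⟩ := exists_countable_disjoint_balls A r R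
    (fun x hx => (hr x hx).1) (fun x hx => (hr x hx).2.1)
  have := hc.to_subtype
  calc μ A ≤ μ (⋃ x ∈ u, Metric.ball x (5 * r x)) := measure_mono hcov
    _ ≤ ∑' x : u, μ (Metric.ball (x : E) (5 * r x)) := measure_biUnion_le _ hc _
    _ ≤ ∑' x : u, (L : ℝ≥0∞) ^ 3 * (2 * μ (Metric.ball (x : E) (r x) ∩ M)) := by
        refine ENNReal.tsum_le_tsum fun x => ?_
        refine (measure_ball_five_mul_le hL (huA x.2).1 (hr x (huA x.2)).1).trans ?_
        gcongr
        exact (hr x (huA x.2)).2.2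
    _ = (L : ℝ≥0∞) ^ 3 * (2 * ∑' x : u, μ (Metric.ball (x : E) (r x) ∩ M)) := by
        rw [ENNReal.tsum_mul_left, ENNReal.tsum_mul_left]
    _ ≤ _ := by
        gcongr
        rw [← measure_biUnion hc
          (hd.mono fun x => Set.inter_subset_left)
          (fun x _ => Metric.isOpen_ball.measurableSet.inter hM)]
        exact measure_mono (Set.iUnion₂_subset fun x _ => Set.inter_subset_right)

/-- If a.e. point lies in finitely many of the sets `N i`, then a.e. point is the centre of
balls half filled by `N i` for finitely many `i` only. -/
lemma ae_finite_centres [IsFiniteMeasure μ]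
    (hL : ∀ x ∈ μ.support, ∀ r : ℝ, 0 < r → μ (Metric.ball x (2 * r)) ≤ L * μ (Metric.ball x r))
    {ι : Type*} [Countable ι] {N : ι → Set E} (hN : ∀ i, MeasurableSet (N i))
    (hfin : ∀ᵐ x ∂μ, {i | x ∈ N i}.Finite) (R : ℝ) :
    ∀ᵐ x ∂μ, x ∈ μ.support → {i | ∃ r, 0 < r ∧ r ≤ R ∧
      μ (Metric.ball x r) ≤ 2 * μ (Metric.ball x r ∩ N i)}.Finite := by
  obtain ⟨e, he⟩ := exists_injective_nat ι
  -- The tails `M n` decrease to a null set. A centre half filled by `N i` for infinitely many `i`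
  -- is half filled by every `M n`, so the weak-type estimate applied to `M n` shows that such
  -- centres form a null set.
  set M : ℕ → Set E := fun n => ⋃ i, ⋃ (_ : n ≤ e i), N i with hMdef
  have hM : ∀ n, MeasurableSet (M n) := fun n =>
    MeasurableSet.iUnion fun i => MeasurableSet.iUnion fun _ => hN i
  have hanti : Antitone M := by
    intro a b hab x hx
    simp only [hMdef, Set.mem_iUnion] at hx ⊢
    obtain ⟨i, hi, hx⟩ := hx
    exact ⟨i, hab.trans hi, hx⟩
  have hnull : μ (⋂ n, M n) = 0 := by
    refine measure_mono_null ?_ (ae_iff.1 hfin)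
    intro x hx hxf
    obtain ⟨n, hn⟩ := (hxf.image e).bddAbove
    have hx' := Set.mem_iInter.1 hx (n + 1)
    simp only [hMdef, Set.mem_iUnion] at hx'
    obtain ⟨i, hi, hxi⟩ := hx'
    have := hn (Set.mem_image_of_mem e hxi)
    omega
  have hlim := tendsto_measure_of_antitone (μ := μ) hM hanti hnull
  have hlim2 : Tendsto (fun n => (L : ℝ≥0∞) ^ 3 * (2 * μ (M n))) atTop (𝓝 0) := by
    have h1 := ENNReal.Tendsto.const_mul (a := 2) hlim (Or.inr (by simp))
    rw [mul_zero] at h1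
    simpa using ENNReal.Tendsto.const_mul (a := (L : ℝ≥0∞) ^ 3) h1 (Or.inr (by simp))
  rw [ae_iff]
  refine le_antisymm (ge_of_tendsto' hlim2 fun n => ?_) bot_le
  refine (measure_mono ?_).trans (measure_centres_le hL (hM n) R)
  intro x hx
  simp only [Set.mem_ofPred_eq, Classical.not_imp] at hx
  refine ⟨hx.1, ?_⟩
  by_contra hno
  refine hx.2 ((((Set.finite_lt_nat n).preimage he.injOn)).subset ?_)
  rintro i ⟨r, hr, hrR, hri⟩
  by_contra hi
  refine hno ⟨r, hr, hrR, hri.trans ?_⟩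
  gcongr
  refine Set.subset_iUnion₂_of_subset i (not_lt.1 hi) subset_rfl

/-- Mass of the points of thin sets `D a` that are centres of balls contained in larger sets
`W a` of which the overlaps of the `W a` fill less than half. -/
lemma tsum_measure_thin_le [IsFiniteMeasure μ]
    (hL : ∀ x ∈ μ.support, ∀ r : ℝ, 0 < r → μ (Metric.ball x (2 * r)) ≤ L * μ (Metric.ball x r))
    {κ : Type*} [Countable κ] {D W : κ → Set E} {N : Set E} (hW : ∀ a, MeasurableSet (W a))
    (hN : MeasurableSet N) (hDis : ∀ a b, a ≠ b → W a ∩ W b ⊆ N) (c : ℝ≥0∞) (R : ℝ) :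
    ∑' a, μ {x | x ∈ D a ∧ x ∈ μ.support ∧ ∃ r, 0 < r ∧ r ≤ R ∧
      2 * μ (Metric.ball x r ∩ N) ≤ μ (Metric.ball x r) ∧
      Metric.ball x r ∩ μ.support ⊆ W a ∧
      μ (Metric.ball x (5 * r) ∩ D a) ≤ c * μ (Metric.ball x (5 * r))} ≤
    c * ((L : ℝ≥0∞) ^ 3 * (2 * μ Set.univ)) := by
  have key : ∀ a, μ {x | x ∈ D a ∧ x ∈ μ.support ∧ ∃ r, 0 < r ∧ r ≤ R ∧
      2 * μ (Metric.ball x r ∩ N) ≤ μ (Metric.ball x r) ∧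
      Metric.ball x r ∩ μ.support ⊆ W a ∧
      μ (Metric.ball x (5 * r) ∩ D a) ≤ c * μ (Metric.ball x (5 * r))} ≤
      c * ((L : ℝ≥0∞) ^ 3 * (2 * μ (W a \ N))) := by
    intro a
    set A := {x | x ∈ D a ∧ x ∈ μ.support ∧ ∃ r, 0 < r ∧ r ≤ R ∧
      2 * μ (Metric.ball x r ∩ N) ≤ μ (Metric.ball x r) ∧
      Metric.ball x r ∩ μ.support ⊆ W a ∧
      μ (Metric.ball x (5 * r) ∩ D a) ≤ c * μ (Metric.ball x (5 * r))} with hA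
    have hex : ∀ x, ∃ r, x ∈ A → 0 < r ∧ r ≤ R ∧
        2 * μ (Metric.ball x r ∩ N) ≤ μ (Metric.ball x r) ∧
        Metric.ball x r ∩ μ.support ⊆ W a ∧
        μ (Metric.ball x (5 * r) ∩ D a) ≤ c * μ (Metric.ball x (5 * r)) := by
      intro x
      by_cases hx : x ∈ A
      · obtain ⟨r, hr⟩ := hx.2.2
        exact ⟨r, fun _ => hr⟩
      · exact ⟨0, fun h => absurd h hx⟩
    choose r hr using hex
    obtain ⟨u, huA, hc, hd, hcov⟩ := exists_countable_disjoint_balls A r R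
      (fun x hx => (hr x hx).1) (fun x hx => (hr x hx).2.1)
    have := hc.to_subtype
    have half : ∀ x ∈ A, μ (Metric.ball x (r x)) ≤ 2 * μ (Metric.ball x (r x) \ N) := by
      intro x hx
      have h1 := (hr x hx).2.2.1
      have h2 := measure_inter_add_sdiff (μ := μ) (Metric.ball x (r x)) hN
      have h3 : 2 * μ (Metric.ball x (r x)) ≤
          μ (Metric.ball x (r x)) + 2 * μ (Metric.ball x (r x) \ N) := by
        conv_lhs => rw [← h2, mul_add]
        gcongr
      rw [two_mul] at h3
      exact (ENNReal.add_le_add_iff_left (measure_ne_top _ _)).1 h3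
    calc μ A ≤ μ (⋃ x ∈ u, Metric.ball x (5 * r x) ∩ D a) := by
          refine measure_mono fun x hx => ?_
          have := hcov hx
          simp only [Set.mem_iUnion, Set.mem_inter_iff] at this ⊢
          obtain ⟨y, hy, hxy⟩ := this
          exact ⟨y, hy, hxy, hx.1⟩
      _ ≤ ∑' x : u, μ (Metric.ball (x : E) (5 * r x) ∩ D a) := measure_biUnion_le _ hc _
      _ ≤ ∑' x : u, c * ((L : ℝ≥0∞) ^ 3 * (2 * μ (Metric.ball (x : E) (r x) \ N))) := by
          refine ENNReal.tsum_le_tsum fun x => ?_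
          have hx := huA x.2
          refine (hr x hx).2.2.2.2.trans ?_
          gcongr
          refine (measure_ball_five_mul_le hL hx.2.1 (hr x hx).1).trans ?_
          gcongr
          exact half x hx
      _ = c * ((L : ℝ≥0∞) ^ 3 * (2 * ∑' x : u, μ (Metric.ball (x : E) (r x) \ N))) := by
          rw [ENNReal.tsum_mul_left, ENNReal.tsum_mul_left, ENNReal.tsum_mul_left]
      _ ≤ _ := by
          gcongr
          rw [← measure_biUnion hc
            (hd.mono fun x => Set.sdiff_subset)
            (fun x _ => Metric.isOpen_ball.measurableSet.diff hN)]
          -- The disjoint balls lie in `W a` only within the support, hence the inclusion up to a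
          -- null set.
          refine measure_mono_ae ?_
          filter_upwards [Measure.support_mem_ae (μ := μ)] with x hxs hx
          obtain ⟨y, hy, hxy⟩ := Set.mem_iUnion₂.1 hx
          exact ⟨(hr y (huA hy)).2.2.2.1 ⟨hxy.1, hxs⟩, hxy.2⟩
  calc _ ≤ ∑' a, c * ((L : ℝ≥0∞) ^ 3 * (2 * μ (W a \ N))) := ENNReal.tsum_le_tsum key
    _ = c * ((L : ℝ≥0∞) ^ 3 * (2 * ∑' a, μ (W a \ N))) := by
        rw [ENNReal.tsum_mul_left, ENNReal.tsum_mul_left, ENNReal.tsum_mul_left]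
    _ ≤ _ := by
        gcongr
        -- Removing `N` removes all overlaps, so the sets `W a \ N` are disjoint and their masses
        -- add up to at most the total mass.
        rw [← measure_iUnion]
        · exact measure_mono (Set.subset_univ _)
        · intro a b hab
          refine Set.disjoint_left.2 fun x hx hx' => hx.2 (hDis a b hab ⟨hx.1, hx'.1⟩)
        · exact fun a => (hW a).diff hN

/-- Inhomogeneous transference: if the overlaps of the thick sets `W i a` meet a.e. point for
finitely many `i` only, and the thin sets `D i a` are contracted in the thick ones at a summable
rate, then a.e. point lies in the thin sets for finitely many `i` only. -/
theorem ae_finite_thin [IsFiniteMeasure μ]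
    (hL : ∀ x ∈ μ.support, ∀ r : ℝ, 0 < r → μ (Metric.ball x (2 * r)) ≤ L * μ (Metric.ball x r))
    {ι κ : Type*} [Countable ι] [Countable κ] {I : ι → Set κ} {D W : ι → κ → Set E}
    (hW : ∀ i a, MeasurableSet (W i a)) {c : ι → ℝ≥0∞} (hc : ∑' i, c i ≠ ∞)
    (hcontr : ∀ i, ∀ a ∈ I i, ∀ x ∈ D i a ∩ μ.support, ∃ r : ℝ, 0 < r ∧
      Metric.ball x r ∩ μ.support ⊆ W i a ∧
      μ (Metric.ball x (5 * r) ∩ D i a) ≤ c i * μ (Metric.ball x (5 * r)))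
    (hover : ∀ᵐ x ∂μ, {i | ∃ a ∈ I i, ∃ b ∈ I i, a ≠ b ∧ x ∈ W i a ∧ x ∈ W i b}.Finite) :
    ∀ᵐ x ∂μ, {i | ∃ a ∈ I i, x ∈ D i a}.Finite := by
  obtain ⟨R, hR0, hR⟩ : ∃ R : ℝ, 0 < R ∧ ∀ x ∈ μ.support, μ.support ⊆ Metric.ball x R := by
    obtain ⟨R, hR⟩ := Metric.isBounded_iff.1 (isBounded_support_of_doubling hL)
    refine ⟨max R 0 + 1, by positivity, fun x hx y hy => ?_⟩
    have := hR hy hx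
    have := le_max_left R 0
    rw [Metric.mem_ball]; linarith
  set N : ι → Set E := fun i => ⋃ a ∈ I i, ⋃ b ∈ I i, ⋃ (_ : a ≠ b), W i a ∩ W i b with hNdef
  have hNmem : ∀ i x, x ∈ N i ↔ ∃ a ∈ I i, ∃ b ∈ I i, a ≠ b ∧ x ∈ W i a ∧ x ∈ W i b := by
    intro i x; simp only [hNdef, Set.mem_iUnion, Set.mem_inter_iff, exists_prop]
  have hN : ∀ i, MeasurableSet (N i) := fun i =>
    MeasurableSet.biUnion (Set.to_countable _) fun a _ =>
      MeasurableSet.biUnion (Set.to_countable _) fun b _ =>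
        MeasurableSet.iUnion fun _ => (hW i a).inter (hW i b)
  have hbad := ae_finite_centres hL hN (by simpa only [hNmem] using hover) R
  have hball : ∀ x ∈ μ.support, ∀ s, R ≤ s → ∀ T : Set E,
      μ (Metric.ball x s ∩ T) = μ T := by
    intro x hx s hs T
    refine measure_congr ?_
    filter_upwards [Measure.support_mem_ae (μ := μ)] with y hy
    refine propext ⟨fun h => h.2, fun h => ⟨Metric.ball_subset_ball hs (hR x hx hy), h⟩⟩
  have hball' : ∀ x ∈ μ.support, ∀ s, R ≤ s → μ (Metric.ball x s) = μ Set.univ := by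
    intro x hx s hs
    simpa using hball x hx s hs Set.univ
  have hcontr' : ∀ i, ∀ a ∈ I i, ∀ x ∈ D i a ∩ μ.support, ∃ r : ℝ, 0 < r ∧ r ≤ R ∧
      Metric.ball x r ∩ μ.support ⊆ W i a ∧
      μ (Metric.ball x (5 * r) ∩ D i a) ≤ c i * μ (Metric.ball x (5 * r)) := by
    intro i a ha x hx
    obtain ⟨r, hr, h1, h2⟩ := hcontr i a ha x hx
    rcases le_total r R with h | h
    · exact ⟨r, hr, h, h1, h2⟩
    -- Balls of radius at least `R` centred in the support contain the whole support, so cutting the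
    -- radius down to `R` changes no measure.
    · refine ⟨R, hR0, le_rfl, fun y hy => h1 ⟨Metric.ball_subset_ball h hy.1, hy.2⟩, ?_⟩
      rw [hball x hx.2 _ (by linarith), hball' x hx.2 _ (by linarith)] at h2 ⊢
      exact h2
  set G : ι → κ → Set E := fun i a => {x | a ∈ I i ∧ x ∈ D i a ∧ x ∈ μ.support ∧
      ∃ r, 0 < r ∧ r ≤ R ∧ 2 * μ (Metric.ball x r ∩ N i) ≤ μ (Metric.ball x r) ∧
      Metric.ball x r ∩ μ.support ⊆ W i a ∧
      μ (Metric.ball x (5 * r) ∩ D i a) ≤ c i * μ (Metric.ball x (5 * r))} with hG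
  have hGsum : ∀ i, μ (⋃ a, G i a) ≤ c i * ((L : ℝ≥0∞) ^ 3 * (2 * μ Set.univ)) := by
    intro i
    refine (measure_mono ?_).trans ((measure_iUnion_le _).trans
      (tsum_measure_thin_le (κ := I i) (D := fun a => D i a) (W := fun a => W i a) hL
        (fun a => hW i a) (hN i) (fun a b hab x hx => (hNmem i x).2
          ⟨a, a.2, b, b.2, fun h => hab (Subtype.ext h), hx.1, hx.2⟩) (c i) R))
    intro x hx
    obtain ⟨a, ha⟩ := Set.mem_iUnion.1 hx
    exact Set.mem_iUnion.2 ⟨⟨a, ha.1⟩, ha.2⟩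
  have hgood : ∀ᵐ x ∂μ, {i | x ∈ ⋃ a, G i a}.Finite := by
    refine ae_finite_setOfPred_mem (ne_top_of_le_ne_top ?_ (ENNReal.tsum_le_tsum hGsum))
    rw [ENNReal.tsum_mul_right]
    exact ENNReal.mul_ne_top hc (ENNReal.mul_ne_top (by simp)
      (ENNReal.mul_ne_top (by simp) (measure_ne_top _ _)))
  filter_upwards [hbad, hgood, Measure.support_mem_ae (μ := μ)] with x hb hg hxs
  refine ((hb hxs).union hg).subset ?_
  rintro i ⟨a, ha, hxD⟩
  obtain ⟨r, hr, hrR, h1, h2⟩ := hcontr' i a ha x ⟨hxD, hxs⟩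
  -- Either overlaps fill half of the contracting ball, which the maximal estimate allows finitely
  -- often, or they do not, and Borel–Cantelli applies.
  rcases le_total (μ (Metric.ball x r)) (2 * μ (Metric.ball x r ∩ N i)) with h | h
  · exact Or.inl ⟨r, hr, hrR, h⟩
  · exact Or.inr (Set.mem_iUnion.2 ⟨a, ha, hxD, hxs, r, hr, hrR, h, h1, h2⟩)

end Covering

/-! ### Covering radius of a lattice without short vectors. -/

section Lattice

variable {ι : Type*} [Fintype ι]

/-- If a linear map expands all nonzero integer vectors to norm at least one, then the images of
the integer vectors form a net with gaps controlled by the determinant. -/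
theorem exists_int_norm_map_sub_lt (T : (ι → ℝ) →ₗ[ℝ] (ι → ℝ))
    (hdet : LinearMap.det T ≠ 0)
    (hT : ∀ z : ι → ℤ, z ≠ 0 → 1 ≤ ‖T (fun i => (z i : ℝ))‖) (x : ι → ℝ) :
    ∃ z : ι → ℤ, ‖T (fun i => (z i : ℝ)) - x‖ < |LinearMap.det T| + 1 := by
  classical
  set D := |LinearMap.det T| with hD
  have hDpos : 0 < D := abs_pos.2 hdet
  by_contra! hfar
  set Λ : Set (ι → ℝ) := Set.range fun z : ι → ℤ => T (fun i => (z i : ℝ)) with hΛ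
  have hne : Λ.Nonempty := Set.range_nonempty _
  set f : (ι → ℝ) → ℝ := fun y => Metric.infDist y Λ with hf
  have hfx : D + 1 ≤ f x := by
    refine (Metric.le_infDist hne).2 ?_
    rintro _ ⟨z, rfl⟩
    rw [dist_comm, dist_eq_norm]
    exact hfar z
  have hf0 : f 0 = 0 := Metric.infDist_zero_of_mem ⟨0, by
    simp only [Pi.zero_apply, Int.cast_zero]
    exact map_zero T⟩
  have hsurj : ∀ s ∈ Set.Icc (0 : ℝ) (f x), ∃ y, f y = s := by
    intro s hs
    have hcont : ContinuousOn (fun t : ℝ => f (t • x)) (Set.Icc 0 1) :=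
      ((Metric.continuous_infDist_pt Λ).comp
        (continuous_id.smul continuous_const)).continuousOn
    have := intermediate_value_Icc zero_le_one hcont
    simp only [zero_smul, one_smul, hf0] at this
    obtain ⟨t, -, ht⟩ := this hs
    exact ⟨_, ht⟩
  -- The distance to the lattice vanishes at `0` and is at least `D + 1` at `x`, so it takes each of
  -- the values `0, …, k - 1`, with `k > D`.
  set k := ⌊D⌋₊ + 1 with hk
  have hkD : D < k := by rw [hk]; push_cast; exact Nat.lt_floor_add_one D
  have hkD' : (k : ℝ) ≤ D + 1 := by
    rw [hk]; push_cast; linarith [Nat.floor_le hDpos.le]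
  have hex : ∀ i : Fin k, ∃ y, f y = (i : ℕ) := by
    intro i
    refine hsurj _ ⟨by positivity, ?_⟩
    have : ((i : ℕ) : ℝ) ≤ k := by exact_mod_cast i.2.le
    linarith
  choose y hy using hex
  have hper : ∀ (z : ι → ℤ) (v : ι → ℝ), f (v + T (fun i => (z i : ℝ))) ≤ f v := by
    intro z v
    refine (Metric.le_infDist hne).2 ?_
    rintro _ ⟨z', rfl⟩
    refine (Metric.infDist_le_dist_of_mem (Set.mem_range_self
      (f := fun z : ι → ℤ => T (fun i => (z i : ℝ))) (z' + z))).trans (le_of_eq ?_)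
    have : T (fun i => (((z' + z) i : ℤ) : ℝ)) = T (fun i => (z' i : ℝ)) + T (fun i => (z i : ℝ)) := by
      rw [← map_add]; congr 1; ext i; simp
    simp only [this, dist_eq_norm]
    congr 1; abel
  have hlip : ∀ (z : ι → ℤ) (v w : ι → ℝ),
      ‖v + T (fun i => (z i : ℝ)) - w‖ < 1 → f v < f w + 1 ∧ f w < f v + 1 := by
    intro z v w hvw
    have h1 : f w ≤ f v + 1 - (1 - ‖v + T (fun i => (z i : ℝ)) - w‖) := by
      have := Metric.infDist_le_infDist_add_dist (s := Λ) (x := w)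
        (y := v + T (fun i => (z i : ℝ)))
      rw [dist_comm, dist_eq_norm] at this
      linarith [hper z v]
    have h2 : f v ≤ f w + 1 - (1 - ‖v + T (fun i => (z i : ℝ)) - w‖) := by
      have := Metric.infDist_le_infDist_add_dist (s := Λ) (x := v)
        (y := w + T (fun i => ((-z) i : ℤ)))
      have h3 : T (fun i => (((-z) i : ℤ) : ℝ)) = - T (fun i => (z i : ℝ)) := by
        rw [← map_neg]; congr 1; ext i; simp
      rw [dist_eq_norm] at this
      have h4 := hper (-z) w
      rw [h3] at this h4
      have h5 : v - (w + -T fun i => (z i : ℝ)) = v + T (fun i => (z i : ℝ)) - w := by abel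
      rw [h5] at this
      linarith
    constructor <;> linarith
  -- Modulo integer vectors these sets are disjoint from one another, since the distance to the
  -- lattice is periodic and 1-Lipschitz and differs by at least one between centres. Each is
  -- disjoint from its own translates, since lattice vectors have norm at least one. A sup-norm ball
  -- of radius `1 / 2` has volume one, so the total volume is `k / D > 1`, against Blichfeldt's
  -- principle.
  set B : Fin k → Set (ι → ℝ) := fun i => T ⁻¹' Metric.ball (y i) (1 / 2) with hB
  have hTc : Continuous T := T.continuous_of_finiteDimensional
  have hBm : ∀ i, MeasurableSet (B i) := fun i =>
    (Metric.isOpen_ball.preimage hTc).measurableSet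
  have hmeet : ∀ i j (z : ι → ℤ) (v : ι → ℝ), v ∈ B i → v + (fun l => (z l : ℝ)) ∈ B j →
      i = j ∧ z = 0 := by
    intro i j z v hv hv'
    simp only [hB, Set.mem_preimage, Metric.mem_ball, map_add, dist_eq_norm] at hv hv'
    have hlt : ‖y i + T (fun i => (z i : ℝ)) - y j‖ < 1 := by
      have : y i + T (fun i => (z i : ℝ)) - y j =
          (T v + T (fun i => (z i : ℝ)) - y j) - (T v - y i) := by abel
      rw [this]
      exact (norm_sub_le _ _).trans_lt (by linarith)
    obtain ⟨h1, h2⟩ := hlip z _ _ hlt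
    rw [hy, hy] at h1 h2
    have hij : i = j := by
      have h1' : (i : ℕ) < j + 1 := by exact_mod_cast h1
      have h2' : (j : ℕ) < i + 1 := by exact_mod_cast h2
      exact Fin.ext (by omega)
    refine ⟨hij, ?_⟩
    by_contra hz
    subst hij
    have := hT z hz
    rw [add_sub_cancel_left] at hlt
    linarith
  have hvol : volume (⋃ i, B i) = k * ENNReal.ofReal D⁻¹ := by
    rw [measure_iUnion _ hBm, tsum_fintype]
    · have : ∀ i, volume (B i) = ENNReal.ofReal D⁻¹ := by
        intro i
        rw [hB, Measure.addHaar_preimage_linearMap _ hdet, Real.volume_pi_ball _ (by norm_num),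
          abs_inv]
        simp [hD]
      simp [this]
    · intro i j hij
      refine Set.disjoint_left.2 fun v hv hv' => hij (hmeet i j 0 v hv ?_).1
      simpa only [Pi.zero_apply, Int.cast_zero, ← Pi.zero_def, add_zero] using hv'
  have hlt : volume (ZSpan.fundamentalDomain (Pi.basisFun ℝ ι)) < volume (⋃ i, B i) := by
    rw [hvol, ZSpan.volume_fundamentalDomain]
    have : (Matrix.of ⇑(Pi.basisFun ℝ ι)) = 1 := by
      ext i j; simp [Matrix.one_apply, Pi.single_apply, eq_comm]
    rw [this, Matrix.det_one, abs_one, ENNReal.ofReal_one, ← ENNReal.ofReal_natCast,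
      ← ENNReal.ofReal_mul (by positivity), ← ENNReal.ofReal_one]
    refine ENNReal.ofReal_lt_ofReal_iff'.2 ⟨?_, by positivity⟩
    rw [← div_eq_mul_inv, one_lt_div hDpos]
    exact hkD
  have hint : ∀ c : (Submodule.span ℤ (Set.range (Pi.basisFun ℝ ι))).toAddSubgroup,
      ∃ z : ι → ℤ, (c : ι → ℝ) = fun i => (z i : ℝ) := by
    intro c
    have := (Pi.basisFun ℝ ι).mem_span_iff_repr_mem ℤ (c : ι → ℝ) |>.1 c.2
    choose z hz using this
    exact ⟨z, by ext i; simpa using (hz i).symm⟩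
  have hcount : Countable (Submodule.span ℤ (Set.range (Pi.basisFun ℝ ι))).toAddSubgroup := by
    choose z hz using hint
    exact Function.Injective.countable (f := z) fun c d hcd => Subtype.ext (by rw [hz, hz, hcd])
  obtain ⟨a, b, hab, hnd⟩ := exists_pair_mem_lattice_not_disjoint_vadd
    (ZSpan.isAddFundamentalDomain' (Pi.basisFun ℝ ι) volume)
    (MeasurableSet.iUnion hBm).nullMeasurableSet hlt
  obtain ⟨_, ⟨v, hv, rfl⟩, w, hw, hvw⟩ := Set.not_disjoint_iff.1 hnd
  obtain ⟨i, hi⟩ := Set.mem_iUnion.1 hv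
  obtain ⟨j, hj⟩ := Set.mem_iUnion.1 hw
  obtain ⟨za, hza⟩ := hint a
  obtain ⟨zb, hzb⟩ := hint b
  have hvw' : (b : ι → ℝ) + w = a + v := hvw
  have hw' : v + (fun l => (((za - zb) l : ℤ) : ℝ)) = w := by
    have : w = v + ((a : ι → ℝ) - b) := by
      rw [eq_sub_of_add_eq' hvw']; abel
    rw [this, hza, hzb]
    ext l; simp
  have := (hmeet i j (za - zb) v hi (hw' ▸ hj)).2
  refine hab (Subtype.ext ?_)
  rw [hza, hzb, sub_eq_zero.1 this]

end Lattice

/-! ### Lower bounds for the inhomogeneous exponents. -/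

section LowerBound

variable {m n : ℕ}

lemma distInt_nonneg (y : Fin m → ℝ) : 0 ≤ distInt y := norm_nonneg _

lemma distInt_lt_of_forall {y : Fin m → ℝ} {A : ℝ} (hA : 0 < A) (p : Fin m → ℤ)
    (h : ∀ j, |y j + p j| < A) : distInt y < A := by
  refine (pi_norm_lt_iff hA).2 fun j => ?_
  have := round_le (y j) (-p j)
  rw [Real.norm_eq_abs]
  refine this.trans_lt ?_
  push_cast
  rw [sub_neg_eq_add]
  exact h j

/-- A system of linear forms with no small values at small integer vectors has inhomogeneous
solutions of controlled size. -/
lemma exists_inhom_solution (hn : 0 < n) (X : MatSpace m n) (θ : Fin m → ℝ) {A B : ℝ}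
    (hA : 0 < A) (hA1 : A ≤ 1) (hB : 0 < B)
    (h : ∀ q : Fin n → ℤ, q ≠ 0 → ‖fun i => (q i : ℝ)‖ < B → A ≤ distInt (affineForm X q 0)) :
    ∃ q : Fin n → ℤ, q ≠ 0 ∧
      distInt (affineForm X q θ) < ((A ^ m * B ^ n)⁻¹ + 1) * A ∧
      ‖fun i => (q i : ℝ)‖ < 2 * ((A ^ m * B ^ n)⁻¹ + 1) * B := by
  set D := (A ^ m * B ^ n)⁻¹ + 1 with hD
  have hDpos : 0 < D := by positivity
  set M : Matrix (Fin m ⊕ Fin n) (Fin m ⊕ Fin n) ℝ :=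
    Matrix.fromBlocks (Matrix.diagonal fun _ => A⁻¹) (Matrix.of fun j i => A⁻¹ * X (j, i)) 0
      (Matrix.diagonal fun _ => B⁻¹) with hM
  have hdet : LinearMap.det (Matrix.toLin' M) = (A ^ m * B ^ n)⁻¹ := by
    rw [LinearMap.det_toLin', hM, Matrix.det_fromBlocks_zero₂₁, Matrix.det_diagonal,
      Matrix.det_diagonal]
    simp [mul_comm]
  have hl : ∀ (z : Fin m ⊕ Fin n → ℤ) j, Matrix.toLin' M (fun i => (z i : ℝ)) (Sum.inl j) =
      A⁻¹ * (∑ i, X (j, i) * (z (Sum.inr i) : ℝ) + z (Sum.inl j)) := by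
    intro z j
    rw [Matrix.toLin'_apply, hM, Matrix.fromBlocks_mulVec]
    simp [Matrix.mulVec, dotProduct, mul_add, Finset.mul_sum, mul_assoc,
      add_comm]
  have hr : ∀ (z : Fin m ⊕ Fin n → ℤ) i, Matrix.toLin' M (fun i => (z i : ℝ)) (Sum.inr i) =
      B⁻¹ * z (Sum.inr i) := by
    intro z j
    rw [Matrix.toLin'_apply, hM, Matrix.fromBlocks_mulVec]
    simp
  have hT : ∀ z : Fin m ⊕ Fin n → ℤ, z ≠ 0 → 1 ≤ ‖Matrix.toLin' M (fun i => (z i : ℝ))‖ := by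
    intro z hz
    by_contra! hlt
    rw [pi_norm_lt_iff one_pos] at hlt
    have h1 : ∀ j, |∑ i, X (j, i) * (z (Sum.inr i) : ℝ) + z (Sum.inl j)| < A := by
      intro j
      have := hlt (Sum.inl j)
      rwa [hl, Real.norm_eq_abs, abs_mul, abs_of_pos (inv_pos.2 hA), inv_mul_lt_iff₀ hA,
        mul_one] at this
    have h2 : ∀ i, |(z (Sum.inr i) : ℝ)| < B := by
      intro i
      have := hlt (Sum.inr i)
      rwa [hr, Real.norm_eq_abs, abs_mul, abs_of_pos (inv_pos.2 hB), inv_mul_lt_iff₀ hB,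
        mul_one] at this
    by_cases hq : (fun i => z (Sum.inr i)) = 0
    · refine hz ?_
      have hq' : ∀ i, z (Sum.inr i) = 0 := fun i => congrFun hq i
      ext (j | i)
      -- When `q = 0`, the bound `A ≤ 1` forces the integers `p j` to vanish.
      · have := (h1 j).trans_le hA1
        simp only [hq', Int.cast_zero, mul_zero, Finset.sum_const_zero, zero_add] at this
        exact Int.abs_lt_one_iff.1 (by exact_mod_cast this)
      · exact hq' i
    · refine absurd (h _ hq ((pi_norm_lt_iff hB).2 h2)) (not_le.2 ?_)
      refine distInt_lt_of_forall hA (fun j => z (Sum.inl j)) fun j => ?_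
      simpa [affineForm] using h1 j
  -- The error is less than `D`, so aiming at `D` instead of `0` in the `q`-coordinates makes every
  -- coordinate of `q` positive; this is what ensures `q ≠ 0`.
  obtain ⟨z, hz⟩ := exists_int_norm_map_sub_lt (Matrix.toLin' M) (by rw [hdet]; positivity) hT
    (Sum.elim (fun j => -(A⁻¹ * θ j)) (fun _ => D))
  rw [hdet, abs_of_pos (by positivity), ← hD, pi_norm_lt_iff hDpos] at hz
  have h2 : ∀ i, 0 < (z (Sum.inr i) : ℝ) ∧ (z (Sum.inr i) : ℝ) < 2 * D * B := by
    intro i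
    have := hz (Sum.inr i)
    rw [Pi.sub_apply, hr, Sum.elim_inr, Real.norm_eq_abs, abs_lt] at this
    constructor
    · have h3 : 0 < B⁻¹ * (z (Sum.inr i) : ℝ) := by linarith
      exact (mul_pos_iff_of_pos_left (inv_pos.2 hB)).1 h3
    · have h3 : B⁻¹ * (z (Sum.inr i) : ℝ) < 2 * D := by linarith
      rw [inv_mul_lt_iff₀ hB] at h3
      linarith
  refine ⟨fun i => z (Sum.inr i), ?_, ?_, ?_⟩
  · intro h0
    have := (h2 ⟨0, hn⟩).1
    rw [show z (Sum.inr ⟨0, hn⟩) = 0 from congrFun h0 _] at this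
    simp at this
  · refine distInt_lt_of_forall (by positivity) (fun j => z (Sum.inl j)) fun j => ?_
    have := hz (Sum.inl j)
    rw [Pi.sub_apply, hl, Sum.elim_inl, Real.norm_eq_abs, sub_neg_eq_add, ← mul_add, abs_mul,
      abs_of_pos (inv_pos.2 hA), inv_mul_lt_iff₀ hA, mul_comm A] at this
    rwa [affineForm, add_right_comm]
  · refine (pi_norm_lt_iff (by positivity)).2 fun i => ?_
    rw [Real.norm_eq_abs, abs_of_pos (h2 i).1]
    exact (h2 i).2

/-- If the bound failed for arbitrarily large `Q`, then `1 + η` would be an admissible exponent. -/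
lemma exists_forall_le_of_exponent_le {X : MatSpace m n} {θ : Fin m → ℝ}
    (h : exponent X θ ≤ 1) {η : ℝ} (hη : 0 < η) :
    ∃ Q₁ : ℝ, ∀ Q, Q₁ < Q → 1 < Q → ∀ q : Fin n → ℤ, q ≠ 0 → ‖fun i => (q i : ℝ)‖ ^ n ≤ Q →
      Q ^ (-(1 + η)) ≤ distInt (affineForm X q θ) ^ m := by
  by_contra! hcon
  have ha : Approximable X θ (1 + η.toNNReal) := fun Q₀ => by
    obtain ⟨Q, h1, h2, q, h3, h4, h5⟩ := hcon Q₀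
    refine ⟨Q, h1, h2, q, h3, ?_, h4⟩
    rwa [NNReal.coe_add, NNReal.coe_one, Real.coe_toNNReal _ hη.le]
  refine absurd ((le_iSup₂_of_le _ ha le_rfl : _ ≤ exponent X θ).trans h) (not_le.2 ?_)
  have : (1 : ℝ≥0) < 1 + η.toNNReal := lt_add_of_pos_right _ (Real.toNNReal_pos.2 hη)
  exact_mod_cast this

lemma exists_forall_le_of_mulExponent_le {X : MatSpace m n} {θ : Fin m → ℝ}
    (h : mulExponent X θ ≤ 1) {η : ℝ} (hη : 0 < η) :
    ∃ Q₁ : ℝ, ∀ Q, Q₁ < Q → 1 < Q → ∀ q : Fin n → ℤ, q ≠ 0 → prodPlus q ≤ Q →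
      Q ^ (-(1 + η)) ≤ prodDistInt (affineForm X q θ) := by
  by_contra! hcon
  have ha : MulApproximable X θ (1 + η.toNNReal) := fun Q₀ => by
    obtain ⟨Q, h1, h2, q, h3, h4, h5⟩ := hcon Q₀
    refine ⟨Q, h1, h2, q, h3, ?_, h4⟩
    rwa [NNReal.coe_add, NNReal.coe_one, Real.coe_toNNReal _ hη.le]
  refine absurd ((le_iSup₂_of_le _ ha le_rfl : _ ≤ mulExponent X θ).trans h) (not_le.2 ?_)
  have : (1 : ℝ≥0) < 1 + η.toNNReal := lt_add_of_pos_right _ (Real.toNNReal_pos.2 hη)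
  exact_mod_cast this

/-- If the homogeneous exponent is at most one, then all inhomogeneous exponents are at least
one. -/
theorem one_le_exponent (hm : 0 < m) (hn : 0 < n) {X : MatSpace m n} (h : exponent X 0 ≤ 1)
    (θ : Fin m → ℝ) : 1 ≤ exponent X θ := by
  refine le_of_forall_lt fun w₀ hw₀ => ?_
  obtain ⟨w, hw₀w, hw1⟩ := ENNReal.lt_iff_exists_nnreal_btwn.1 hw₀
  refine hw₀w.trans_le (le_iSup₂_of_le w ?_ le_rfl)
  have hw : (w : ℝ) < 1 := by exact_mod_cast hw1
  have hw0 : (0 : ℝ) ≤ w := w.2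
  have hmR : (1 : ℝ) ≤ m := by exact_mod_cast hm
  have hnR : (1 : ℝ) ≤ n := by exact_mod_cast hn
  set η : ℝ := (1 - w) / (2 * (m + n)) with hη
  have hηpos : 0 < η := div_pos (by linarith) (by positivity)
  have hηeq : (m + n) * η = (1 - w) / 2 := by rw [hη]; field_simp
  obtain ⟨Q₁, hQ₁⟩ := exists_forall_le_of_exponent_le h hηpos
  intro Q₀
  -- The exponent to spare when the solution of size `4 ^ n * Q ^ (n * η + 1)` is tested against
  -- `w`. The choice of `η` keeps it positive, so `Q ^ g` eventually absorbs the constants `2 ^ m *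
  -- 4 ^ n`.
  set g : ℝ := 1 + η - m * η - w * (n * η + 1) with hg
  have hgpos : 0 < g := by
    have : (w : ℝ) * (n * η) ≤ n * η := mul_le_of_le_one_left (by positivity) hw.le
    nlinarith
  obtain ⟨Q, hQ, hQ0, hQQ₁, hQ1⟩ := (((tendsto_rpow_atTop hgpos).eventually_ge_atTop
    (2 ^ m * 4 ^ n : ℝ)).and ((eventually_gt_atTop Q₀).and
      ((eventually_gt_atTop Q₁).and (eventually_gt_atTop 1)))).exists
  have hQpos : 0 < Q := by linarith
  have hAm : (Q ^ (-(1 + η) / m)) ^ m = Q ^ (-(1 + η)) := by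
    rw [← Real.rpow_natCast, ← Real.rpow_mul hQpos.le]; congr 1; field_simp
  have hBn : (Q ^ (1 / n : ℝ)) ^ n = Q := by
    rw [← Real.rpow_natCast, ← Real.rpow_mul hQpos.le]
    rw [one_div_mul_cancel (by positivity), Real.rpow_one]
  obtain ⟨q, hq0, hq1, hq2⟩ := exists_inhom_solution hn X θ (A := Q ^ (-(1 + η) / m))
    (B := Q ^ (1 / n : ℝ)) (by positivity)
    (Real.rpow_le_one_of_one_le_of_nonpos hQ1.le
      (div_nonpos_of_nonpos_of_nonneg (by linarith) (by positivity))) (by positivity) (by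
    intro q hq hqB
    by_contra! hlt
    refine absurd (hQ₁ Q hQQ₁ hQ1 q hq ?_) (not_le.2 ?_)
    · exact (pow_le_pow_left₀ (norm_nonneg _) hqB.le _).trans_eq hBn
    · rw [← hAm]
      exact pow_lt_pow_left₀ hlt (distInt_nonneg _) hm.ne')
  have hAB : ((Q ^ (-(1 + η) / m)) ^ m * (Q ^ (1 / n : ℝ)) ^ n)⁻¹ = Q ^ η := by
    rw [hAm, hBn, ← Real.rpow_add_one hQpos.ne', ← Real.rpow_neg hQpos.le]; congr 1; ring
  rw [hAB] at hq1 hq2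
  have hD : Q ^ η + 1 ≤ 2 * Q ^ η := by
    linarith [Real.one_le_rpow hQ1.le hηpos.le]
  have hQ2 : (4 * Q ^ η * Q ^ (1 / n : ℝ)) ^ n = 4 ^ n * Q ^ (n * η + 1) := by
    rw [mul_pow, mul_pow, hBn, ← Real.rpow_natCast (Q ^ η), ← Real.rpow_mul hQpos.le, mul_assoc,
      ← Real.rpow_add_one hQpos.ne', mul_comm η]
  have hbig : Q ≤ 4 ^ n * Q ^ (n * η + 1) := by
    calc Q = 1 * Q ^ (1 : ℝ) := by simp
      _ ≤ _ := by
        gcongr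
        · exact one_le_pow₀ (by norm_num)
        · exact hQ1.le
        · have : 0 ≤ n * η := by positivity
          linarith
  refine ⟨4 ^ n * Q ^ (n * η + 1), by linarith, by linarith, q, hq0, ?_, ?_⟩
  · calc distInt (affineForm X q θ) ^ m < (2 * Q ^ η * Q ^ (-(1 + η) / m)) ^ m := by
          refine pow_lt_pow_left₀ (hq1.trans_le ?_) (distInt_nonneg _) hm.ne'
          gcongr
      _ = 2 ^ m * Q ^ (m * η - (1 + η)) := by
          rw [mul_pow, mul_pow, hAm, ← Real.rpow_natCast (Q ^ η), ← Real.rpow_mul hQpos.le,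
            mul_assoc, ← Real.rpow_add hQpos, mul_comm η]
          rfl
      _ ≤ (4 ^ n)⁻¹ * Q ^ (-(w * (n * η + 1))) := by
          rw [inv_mul_eq_div, le_div_iff₀ (by positivity)]
          calc 2 ^ m * Q ^ (m * η - (1 + η)) * 4 ^ n
              = 2 ^ m * 4 ^ n * Q ^ (m * η - (1 + η)) := by ring
            _ ≤ Q ^ g * Q ^ (m * η - (1 + η)) := by gcongr
            _ = _ := by rw [← Real.rpow_add hQpos, hg]; congr 1; ring
      _ ≤ (4 ^ n * Q ^ (n * η + 1)) ^ (-(w : ℝ)) := by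
          rw [Real.mul_rpow (by positivity) (by positivity), ← Real.rpow_mul hQpos.le]
          gcongr ?_ * ?_
          · rw [← Real.rpow_neg_one]
            exact Real.rpow_le_rpow_of_exponent_le (one_le_pow₀ (by norm_num)) (by linarith)
          · exact le_of_eq (by congr 1; ring)
  · rw [← hQ2]
    refine pow_le_pow_left₀ (norm_nonneg _) (hq2.le.trans ?_) _
    calc 2 * (Q ^ η + 1) * Q ^ (1 / n : ℝ) ≤ 2 * (2 * Q ^ η) * Q ^ (1 / n : ℝ) := by gcongr
      _ = _ := by ring

/-- Each factor is at most the supremum norm; for `prodPlus` this uses `|q| ≥ 1`, which holds as `q`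
is a nonzero integer vector. -/
lemma exponent_le_mulExponent (X : MatSpace m n) (θ : Fin m → ℝ) :
    exponent X θ ≤ mulExponent X θ := by
  refine iSup₂_le fun w hw => le_iSup₂_of_le w (fun Q₀ => ?_) le_rfl
  obtain ⟨Q, hQ₀, hQ1, q, hq, hd, hqQ⟩ := hw Q₀
  refine ⟨Q, hQ₀, hQ1, q, hq, lt_of_le_of_lt ?_ hd, le_trans ?_ hqQ⟩
  · calc prodDistInt (affineForm X q θ) ≤ ∏ _j : Fin m, distInt (affineForm X q θ) :=
          Finset.prod_le_prod (fun _ _ => abs_nonneg _) fun j _ =>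
            norm_le_pi_norm
              (fun j => affineForm X q θ j - (round (affineForm X q θ j) : ℝ)) j
      _ = _ := by simp
  · obtain ⟨i, hi⟩ := Function.ne_iff.1 hq
    have h1 : (1 : ℝ) ≤ ‖fun i => (q i : ℝ)‖ := by
      refine le_trans ?_ (norm_le_pi_norm (fun i => (q i : ℝ)) i)
      rw [Real.norm_eq_abs]
      exact_mod_cast Int.one_le_abs hi
    calc prodPlus q ≤ ∏ _i : Fin n, ‖fun i => (q i : ℝ)‖ :=
          Finset.prod_le_prod (fun _ _ => by positivity) fun j _ =>
            max_le h1 (norm_le_pi_norm (fun i => (q i : ℝ)) j)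
      _ = _ := by simp

end LowerBound

/-! ### Slabs around rational planes, their overlaps and their contraction. -/

/-- The matrices `X` for which the coordinates in `J` of `X q + θ + p` are smaller than `ρ`. -/
def slab {m n : ℕ} (J : Finset (Fin m)) (q : Fin n → ℤ) (p : Fin m → ℤ) (θ ρ : Fin m → ℝ) :
    Set (MatSpace m n) :=
  {X | ∀ j ∈ J, |affineForm X q θ j + p j| < ρ j}

section Slab

variable {m n : ℕ}

lemma isOpen_slab (J : Finset (Fin m)) (q : Fin n → ℤ) (p : Fin m → ℤ) (θ ρ : Fin m → ℝ) :
    IsOpen (slab J q p θ ρ) := by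
  have : slab J q p θ ρ =
      ⋂ j ∈ J, {X : MatSpace m n | |affineForm X q θ j + p j| < ρ j} := by
    ext X; simp [slab]
  rw [this]
  refine isOpen_biInter_finset fun j _ => isOpen_lt ?_ continuous_const
  unfold affineForm
  fun_prop

lemma slab_inter_slab_subset {J : Finset (Fin m)} {q q' : Fin n → ℤ} {p p' : Fin m → ℤ}
    {θ ρ : Fin m → ℝ} :
    slab J q p θ ρ ∩ slab J q' p' θ ρ ⊆ slab J (q - q') (p - p') 0 (fun j => 2 * ρ j) := by
  rintro X ⟨h, h'⟩ j hj
  have e : affineForm X (q - q') 0 j + ((p - p') j : ℤ) =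
      (affineForm X q θ j + p j) - (affineForm X q' θ j + p' j) := by
    simp only [affineForm, Pi.sub_apply, Int.cast_sub, mul_sub, Finset.sum_sub_distrib,
      Pi.zero_apply]
    ring
  rw [e]
  have := abs_sub (affineForm X q θ j + p j) (affineForm X q' θ j + p' j)
  linarith [h j hj, h' j hj]

/-- Inhomogeneous transference for neighbourhoods of rational planes. -/
theorem ae_finite_slab {μ : Measure (MatSpace m n)} [IsFiniteMeasure μ] (hd : IsDoubling μ)
    (θ : Fin m → ℝ) {ι : Type*} [Countable ι] (J : ι → Finset (Fin m)) (ρ ρ' : ι → Fin m → ℝ)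
    (V : ι → Set (Fin n → ℤ)) (c : ι → ℝ≥0∞) (hc : ∑' i, c i ≠ ∞)
    (hwide : ∀ i, ∀ j ∈ J i, (V i).Nonempty → 2 * ρ' i j ≤ 1)
    (hcontr : ∀ i, ∀ q ∈ V i, q ≠ 0 → ∀ p, ∀ X ∈ slab (J i) q p θ (ρ i) ∩ μ.support,
      ∃ r : ℝ, 0 < r ∧ Metric.ball X r ∩ μ.support ⊆ slab (J i) q p θ (ρ' i) ∧
      μ (Metric.ball X (5 * r) ∩ slab (J i) q p θ (ρ i)) ≤ c i * μ (Metric.ball X (5 * r)))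
    (hhom : ∀ᵐ X ∂μ, {i | ∃ q ∈ V i, ∃ q' ∈ V i, q ≠ q' ∧
      ∃ p, X ∈ slab (J i) (q - q') p 0 (fun j => 2 * ρ' i j)}.Finite) :
    ∀ᵐ X ∂μ, {i | ∃ q ∈ V i, q ≠ 0 ∧ ∃ p, X ∈ slab (J i) q p θ (ρ i)}.Finite := by
  obtain ⟨L, -, hL⟩ := hd
  -- A slab does not see `p` outside `J`, so `p` is normalised to vanish there; otherwise one slab
  -- would carry several indices and overlap itself. With this, slabs with equal `q` that meet have
  -- equal `p`, because `2 * ρ' ≤ 1` on `J`.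
  have key := ae_finite_thin hL (κ := (Fin n → ℤ) × (Fin m → ℤ))
    (I := fun i => {a | a.1 ∈ V i ∧ a.1 ≠ 0 ∧ ∀ j ∉ J i, a.2 j = 0})
    (D := fun i a => slab (J i) a.1 a.2 θ (ρ i)) (W := fun i a => slab (J i) a.1 a.2 θ (ρ' i))
    (fun i a => (isOpen_slab _ _ _ _ _).measurableSet) hc
    (fun i a ha X hX => hcontr i a.1 ha.1 ha.2.1 a.2 X hX) ?_
  · filter_upwards [key] with X hX
    refine hX.subset ?_
    rintro i ⟨q, hq, hq0, p, hp⟩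
    classical
    refine ⟨⟨q, fun j => if j ∈ J i then p j else 0⟩, ⟨hq, hq0, fun j hj => by simp [hj]⟩,
      fun j hj => ?_⟩
    simpa [hj] using hp j hj
  · filter_upwards [hhom] with X hX
    refine hX.subset ?_
    rintro i ⟨⟨q, p⟩, ⟨hq, hq0, hp⟩, ⟨q', p'⟩, ⟨hq', hq0', hp'⟩, hne, h, h'⟩
    have hs := slab_inter_slab_subset ⟨h, h'⟩
    refine ⟨q, hq, q', hq', ?_, p - p', hs⟩
    rintro rfl
    refine hne (Prod.ext rfl (funext fun j => ?_))
    by_cases hj : j ∈ J i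
    · have h1 := (hs j hj).trans_le (hwide i j hj ⟨q, hq⟩)
      simp only [sub_self, affineForm, Pi.zero_apply, Int.cast_zero, mul_zero,
        Finset.sum_const_zero, zero_add] at h1
      have h2 := Int.abs_lt_one_iff.1 (by exact_mod_cast h1 : |(p - p') j| < 1)
      exact sub_eq_zero.1 h2
    · exact (hp j hj).trans (hp' j hj).symm

/-- Decay only concerns the support, so it passes to sets that are compared with plane
neighbourhoods on the support alone. This matters for slabs that constrain only some of the rows. -/
lemma contracts_of_decayAt {μ : Measure (MatSpace m n)} {C α κ : ℝ} {a : Fin n → ℝ}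
    {b ε : Fin m → ℝ} {D W : Set (MatSpace m n)} (h : DecayAt μ C α a b ε κ)
    (hD : ∀ X ∈ μ.support, X ∈ planeNhd a b (κ • ε) ↔ X ∈ D)
    (hW : ∀ X ∈ μ.support, X ∈ planeNhd a b ε → X ∈ W) :
    ∀ X ∈ D ∩ μ.support, ∃ r : ℝ, 0 < r ∧ Metric.ball X r ∩ μ.support ⊆ W ∧
      μ (Metric.ball X (5 * r) ∩ D) ≤
        ENNReal.ofReal (C * κ ^ α) * μ (Metric.ball X (5 * r)) := by
  rintro X ⟨hX, hXs⟩
  obtain ⟨r, hr, h1, h2⟩ := h X ⟨(hD X hXs).2 hX, hXs⟩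
  refine ⟨r, hr, fun Y hY => hW Y hY.2 (h1 hY), le_trans (le_of_eq (measure_congr ?_)) h2⟩
  filter_upwards [Measure.support_mem_ae (μ := μ)] with Y hY
  exact propext (and_congr_right fun _ => (hD Y hY).symm)

/-- The Euclidean length of an integer vector. -/
noncomputable def euclLength (q : Fin n → ℤ) : ℝ := √(∑ i, (q i : ℝ) ^ 2)

lemma one_le_euclLength {q : Fin n → ℤ} (hq : q ≠ 0) : 1 ≤ euclLength q := by
  obtain ⟨i, hi⟩ := Function.ne_iff.1 hq
  rw [euclLength, Real.one_le_sqrt]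
  have h1 : (1 : ℤ) ≤ q i ^ 2 := by
    have : q i ^ 2 ≠ 0 := pow_ne_zero _ hi
    have := sq_nonneg (q i)
    omega
  calc (1 : ℝ) ≤ (q i : ℝ) ^ 2 := by exact_mod_cast h1
    _ ≤ _ := Finset.single_le_sum (f := fun i => (q i : ℝ) ^ 2) (fun _ _ => sq_nonneg _)
        (Finset.mem_univ i)

lemma sum_sq_div_euclLength {q : Fin n → ℤ} (hq : q ≠ 0) :
    ∑ i, ((q i : ℝ) / euclLength q) ^ 2 = 1 := by
  have h := one_le_euclLength hq
  have h2 : euclLength q ^ 2 = ∑ i, (q i : ℝ) ^ 2 :=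
    Real.sq_sqrt (Finset.sum_nonneg fun _ _ => sq_nonneg _)
  simp_rw [div_pow, ← Finset.sum_div]
  rw [h2]
  exact div_self (by rw [← h2]; positivity)

lemma abs_form_lt_iff {q : Fin n → ℤ} (X : MatSpace m n) (θ : Fin m → ℝ) (p : Fin m → ℤ) (j : Fin m)
    {N : ℝ} (hN : 0 < N) (ρ : ℝ) :
    |∑ i, X (j, i) * ((q i : ℝ) / N) + (θ j + p j) / N| < ρ / N ↔
      |affineForm X q θ j + p j| < ρ := by
  have : ∑ i, X (j, i) * ((q i : ℝ) / N) + (θ j + p j) / N =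
      (affineForm X q θ j + p j) / N := by
    rw [affineForm, add_assoc, add_div _ (θ j + p j), Finset.sum_div]
    congr 1
    exact Finset.sum_congr rfl fun i _ => by ring
  rw [this, abs_div, abs_of_pos hN, div_lt_div_iff_of_pos_right hN]

/-- Dividing by the Euclidean length of `q` gives a unit normal vector. That length is at least one,
so the normalised widths only shrink and stay below `r₀`. -/
lemma Contracting.exists_slab_contracts {μ : Measure (MatSpace m n)} (hμ : Contracting μ) :
    ∃ C α r₀ : ℝ, 0 < C ∧ 0 < α ∧ 0 < r₀ ∧ ∀ (q : Fin n → ℤ) (p : Fin m → ℤ) (θ : Fin m → ℝ)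
      (ρ κ : ℝ), q ≠ 0 → 0 < ρ → 0 < κ → κ < 1 → ρ / κ < r₀ →
      ∀ X ∈ slab Finset.univ q p θ (fun _ => ρ) ∩ μ.support,
        ∃ r : ℝ, 0 < r ∧ Metric.ball X r ∩ μ.support ⊆ slab Finset.univ q p θ (fun _ => ρ / κ) ∧
          μ (Metric.ball X (5 * r) ∩ slab Finset.univ q p θ (fun _ => ρ)) ≤
            ENNReal.ofReal (C * κ ^ α) * μ (Metric.ball X (5 * r)) := by
  obtain ⟨C, α, r₀, hC, hα, hr₀, hdec⟩ := hμ.decay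
  refine ⟨C, α, r₀, hC, hα, hr₀, fun q p θ ρ κ hq hρ hκ hκ1 hlt => ?_⟩
  have hN := one_le_euclLength hq
  have hN0 : 0 < euclLength q := by linarith
  refine contracts_of_decayAt (hdec (fun i => (q i : ℝ) / euclLength q)
    (fun j => (θ j + p j) / euclLength q) (sum_sq_div_euclLength hq) (ρ / κ / euclLength q)
    (by positivity) ((div_le_self (by positivity) hN).trans_lt hlt) κ hκ hκ1) ?_ ?_
  · intro X _
    have e : ρ / euclLength q = κ * (ρ / κ / euclLength q) := by field_simp
    simp only [planeNhd, slab, Set.mem_ofPred_eq, Pi.smul_apply, smul_eq_mul, ← e,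
      abs_form_lt_iff X θ p _ hN0, Finset.mem_univ, true_implies]
  · intro X _ hX j _
    exact (abs_form_lt_iff X θ p j hN0 _).1 (hX j)

lemma abs_form_le_of_norm_le {X : MatSpace m n} {R : ℝ} (hX : ‖X‖ ≤ R) {a : Fin n → ℝ}
    (ha : ∑ i, a i ^ 2 = 1) (j : Fin m) : |∑ i, X (j, i) * a i| ≤ n * R := by
  have hR : 0 ≤ R := (norm_nonneg _).trans hX
  calc |∑ i, X (j, i) * a i| ≤ ∑ i, |X (j, i) * a i| := Finset.abs_sum_le_sum_abs _ _
    _ ≤ ∑ _i : Fin n, R := by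
        refine Finset.sum_le_sum fun i _ => ?_
        have h1 : |a i| ≤ 1 := by
          rw [← sq_le_one_iff_abs_le_one, ← ha]
          exact Finset.single_le_sum (f := fun i => a i ^ 2) (fun _ _ => sq_nonneg _)
            (Finset.mem_univ i)
        have h2 : |X (j, i)| ≤ R := (PiLp.norm_apply_le X (j, i)).trans hX
        rw [abs_mul]
        calc |X (j, i)| * |a i| ≤ R * 1 := by gcongr
          _ = R := mul_one R
    _ = n * R := by simp

lemma StronglyContracting.exists_slab_contracts {μ : Measure (MatSpace m n)}
    (hμ : StronglyContracting μ) :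
    ∃ C α r₀ : ℝ, 0 < C ∧ 0 < α ∧ 0 < r₀ ∧ ∀ (J : Finset (Fin m)) (q : Fin n → ℤ)
      (p : Fin m → ℤ) (θ ρ : Fin m → ℝ) (κ : ℝ), q ≠ 0 → (∀ j, 0 < ρ j) → 0 < κ → κ < 1 →
      (∃ j ∈ J, ρ j / κ < r₀) →
      ∀ X ∈ slab J q p θ ρ ∩ μ.support,
        ∃ r : ℝ, 0 < r ∧ Metric.ball X r ∩ μ.support ⊆ slab J q p θ (fun j => ρ j / κ) ∧
          μ (Metric.ball X (5 * r) ∩ slab J q p θ ρ) ≤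
            ENNReal.ofReal (C * κ ^ α) * μ (Metric.ball X (5 * r)) := by
  classical
  have := hμ.finite
  obtain ⟨C, α, r₀, hC, hα, hr₀, hdec⟩ := hμ.decay
  obtain ⟨L, -, hL⟩ := hμ.doubling
  obtain ⟨R, hR0, hR⟩ := (isBounded_support_of_doubling hL).exists_pos_norm_le
  refine ⟨C, α, r₀, hC, hα, hr₀, fun J q p θ ρ κ hq hρ hκ hκ1 ⟨j₀, hj₀, hlt⟩ => ?_⟩
  have hN := one_le_euclLength hq
  have hN0 : 0 < euclLength q := by linarith
  -- Rows outside `J` get shift zero and a width so large that even after multiplication by `κ` it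
  -- exceeds every value `|X_j a|` on the bounded support, so they impose no condition. Only the
  -- smallest width has to be below `r₀`, and this is where strong contraction is needed.
  set ε : Fin m → ℝ := fun j => if j ∈ J then ρ j / κ / euclLength q else (n * R + 1) / κ with hε
  have hεpos : ∀ j, 0 < ε j := by
    intro j
    have := hρ j
    rw [hε]
    dsimp only
    split_ifs <;> positivity
  refine contracts_of_decayAt (hdec (fun i => (q i : ℝ) / euclLength q)
    (fun j => if j ∈ J then (θ j + p j) / euclLength q else 0) (sum_sq_div_euclLength hq) ε
    hεpos ⟨j₀, ?_⟩ κ hκ hκ1) ?_ ?_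
  · have := hρ j₀
    rw [hε]
    simp only [hj₀, if_true]
    exact (div_le_self (by positivity) hN).trans_lt hlt
  · intro X hX
    refine forall_congr' fun j => ?_
    by_cases hj : j ∈ J
    · have e : κ * ε j = ρ j / euclLength q := by
        simp only [hε, hj, if_true]
        field_simp
      simp only [Pi.smul_apply, smul_eq_mul, e, hj, if_true, abs_form_lt_iff X θ p _ hN0,
        true_implies]
    · have e : κ * ε j = n * R + 1 := by
        simp only [hε, hj, if_false]
        field_simp
      simp only [Pi.smul_apply, smul_eq_mul, e, hj, if_false, add_zero, false_implies, iff_true]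
      linarith [abs_form_le_of_norm_le (hR X hX) (sum_sq_div_euclLength hq) j]
  · intro X _ hX j hj
    have := hX j
    simp only [hε, hj, if_true] at this
    exact (abs_form_lt_iff X θ p j hN0 _).1 this

end Slab

/-! ### Upper bound for the inhomogeneous exponent. -/

section UpperBound

variable {m n : ℕ}

/-- Collects what "large scale" means for both upper bounds: the inequality with `t * (δ / 4)`
contradicts the homogeneous exponent on overlaps, and the one with `m * K` makes the thick slabs
narrow compared with `r₀` and with the spacing of the integers. -/
lemma exists_scale (m n : ℕ) {δ r₀ : ℝ} (hδ : 0 < δ) (hr₀ : 0 < r₀) :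
    ∃ K t₀ : ℕ, 3 ≤ K ∧ (2 : ℝ) ^ (2 - K : ℝ) < r₀ ∧ ∀ t : ℕ, t₀ ≤ t →
      1 ≤ t ∧ 3 * m + 1 + δ + 2 * n * (1 + δ / 4) < t * (δ / 4) ∧ m * K + 1 + δ ≤ (t : ℝ) := by
  obtain ⟨K, hK⟩ := exists_pow_lt_of_lt_one (show 0 < r₀ / 4 by positivity)
    (show (1 / 2 : ℝ) < 1 by norm_num)
  have h1 : Tendsto (fun t : ℕ => (t : ℝ) * (δ / 4)) atTop atTop :=
    tendsto_natCast_atTop_atTop.atTop_mul_const (by positivity)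
  obtain ⟨t₀, ht₀⟩ := eventually_atTop.1 ((eventually_ge_atTop 1).and
    ((h1.eventually_gt_atTop (3 * m + 1 + δ + 2 * n * (1 + δ / 4))).and
    (tendsto_natCast_atTop_atTop.eventually_ge_atTop (m * ((K + 3 : ℕ) : ℝ) + 1 + δ))))
  refine ⟨K + 3, t₀, by omega, lt_of_le_of_lt ?_ (show 4 * (1 / 2) ^ K < r₀ by linarith), ht₀⟩
  have : (4 * (1 / 2) ^ K : ℝ) = 2 ^ (2 - K : ℝ) := by
    rw [Real.rpow_sub two_pos, Real.rpow_natCast, one_div, inv_pow, div_eq_mul_inv]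
    norm_num
  rw [this]
  exact Real.rpow_le_rpow_of_exponent_le one_le_two (by push_cast; linarith)

lemma finite_setOf_two_pow_le (Q : ℝ) (k : ℕ) : {t : ℕ | (2 : ℝ) ^ (t + k) ≤ Q}.Finite := by
  obtain ⟨N, hN⟩ := pow_unbounded_of_one_lt Q (one_lt_two (α := ℝ))
  refine (Set.finite_lt_nat N).subset fun t ht => ?_
  have h : (2 : ℝ) ^ (t + k) < 2 ^ N := lt_of_le_of_lt ht hN
  have := (pow_lt_pow_iff_right₀ (one_lt_two (α := ℝ))).1 h
  exact lt_of_le_of_lt (Nat.le_add_right t k) this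

/-- Every large real number lies in a dyadic interval with large index. -/
lemma exists_dyadic (N : ℕ) {Q : ℝ} (hQ : 2 ^ N < Q) :
    ∃ t : ℕ, N < t ∧ (2 : ℝ) ^ ((t : ℝ) - 1) ≤ Q ∧ Q < 2 ^ t := by
  have h1 : (1 : ℝ) ≤ 2 ^ N := one_le_pow₀ one_le_two
  obtain ⟨k, hk, hk'⟩ := exists_nat_pow_near (h1.trans hQ.le) (one_lt_two (α := ℝ))
  refine ⟨k + 1, (pow_lt_pow_iff_right₀ (one_lt_two (α := ℝ))).1 (hQ.trans hk'), ?_, hk'⟩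
  rw [show (((k + 1 : ℕ) : ℝ) - 1) = (k : ℝ) by push_cast; ring, Real.rpow_natCast]
  exact hk

lemma Approximable.anti {X : MatSpace m n} {θ : Fin m → ℝ} {w w' : ℝ≥0}
    (h : Approximable X θ w) (hw : w' ≤ w) : Approximable X θ w' := by
  intro Q₀
  obtain ⟨Q, h1, h2, q, h3, h4, h5⟩ := h Q₀
  exact ⟨Q, h1, h2, q, h3, h4.trans_le (Real.rpow_le_rpow_of_exponent_le h2.le
    (neg_le_neg (by exact_mod_cast hw))), h5⟩

lemma MulApproximable.anti {X : MatSpace m n} {θ : Fin m → ℝ} {w w' : ℝ≥0}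
    (h : MulApproximable X θ w) (hw : w' ≤ w) : MulApproximable X θ w' := by
  intro Q₀
  obtain ⟨Q, h1, h2, q, h3, h4, h5⟩ := h Q₀
  exact ⟨Q, h1, h2, q, h3, h4.trans_le (Real.rpow_le_rpow_of_exponent_le h2.le
    (neg_le_neg (by exact_mod_cast hw))), h5⟩

lemma exists_one_add_inv_le {w : ℝ≥0} (hw : 1 < w) :
    ∃ k : ℕ, 1 + 1 / ((k : ℝ≥0) + 1) ≤ w := by
  obtain ⟨k, hk⟩ := exists_nat_one_div_lt (show (0 : ℝ) < w - 1 by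
    have : (1 : ℝ) < w := by exact_mod_cast hw
    linarith)
  refine ⟨k, ?_⟩
  rw [← NNReal.coe_le_coe]
  push_cast
  linarith

lemma exponent_le_one {X : MatSpace m n} {θ : Fin m → ℝ}
    (h : ∀ k : ℕ, ¬ Approximable X θ (1 + 1 / ((k : ℝ≥0) + 1))) : exponent X θ ≤ 1 := by
  refine iSup₂_le fun w hw => ?_
  by_contra! hlt
  obtain ⟨k, hk⟩ := exists_one_add_inv_le (show 1 < w by exact_mod_cast hlt)
  exact h k (hw.anti hk)

lemma mulExponent_le_one {X : MatSpace m n} {θ : Fin m → ℝ}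
    (h : ∀ k : ℕ, ¬ MulApproximable X θ (1 + 1 / ((k : ℝ≥0) + 1))) : mulExponent X θ ≤ 1 := by
  refine iSup₂_le fun w hw => ?_
  by_contra! hlt
  obtain ⟨k, hk⟩ := exists_one_add_inv_le (show 1 < w by exact_mod_cast hlt)
  exact h k (hw.anti hk)

lemma two_rpow_neg_rpow (x α : ℝ) (t : ℕ) :
    ((2 : ℝ) ^ (-(t * x))) ^ α = (2 ^ (-(x * α))) ^ t := by
  rw [← Real.rpow_mul zero_le_two, ← Real.rpow_natCast, ← Real.rpow_mul zero_le_two]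
  congr 1; ring

theorem Contracting.ae_not_approximable (hm : 0 < m) {μ : Measure (MatSpace m n)}
    (hμ : Contracting μ) (hext : ∀ᵐ X ∂μ, exponent X 0 ≤ 1) (θ : Fin m → ℝ) {δ : ℝ≥0}
    (hδ0 : 0 < δ) : ∀ᵐ X ∂μ, ¬ Approximable X θ (1 + δ) := by
  have := hμ.finite
  have hδ : (0 : ℝ) < δ := hδ0
  have hmR : (0 : ℝ) < m := by exact_mod_cast hm
  obtain ⟨C, α, r₀, hC, hα, hr₀, hslab⟩ := hμ.exists_slab_contracts
  obtain ⟨K, t₀, hK3, hKr, hscale⟩ := exists_scale m n hδ hr₀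
  have hK3' : (3 : ℝ) ≤ K := by exact_mod_cast hK3
  -- Widening every row by `2 ^ (t * x)` costs `δ / 2` of the exponent `1 + δ`. The remaining `1 + δ
  -- / 2` still beats the homogeneous bound, used with `1 + δ / 4`.
  set x : ℝ := δ / (2 * m) with hx
  have hxpos : 0 < x := by positivity
  have hmx : m * x = δ / 2 := by rw [hx]; field_simp
  -- For `2 ^ (t - 1) ≤ Q < 2 ^ t` the lower end bounds the approximation error and the upper end
  -- bounds `q`, hence `t - 1` here and `2 ^ t` in the set of admissible `q`.
  set ρ : ℕ → ℝ := fun t => 2 ^ (-(((t : ℝ) - 1) * (1 + δ) / m)) with hρ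
  set κ : ℕ → ℝ := fun t => 2 ^ (-((t : ℝ) * x)) with hκ
  set y : ℕ → ℝ := fun t => ((t : ℝ) * (1 + δ / 2) - 1 - δ) / m with hy
  have hmy : ∀ t, m * y t = (t : ℝ) * (1 + δ / 2) - 1 - δ := fun t => by
    simp only [hy]; field_simp
  have hρκ : ∀ t, ρ t / κ t = 2 ^ (-y t) := by
    intro t
    simp only [hρ, hκ, hy]
    rw [← Real.rpow_sub two_pos]
    congr 1
    rw [hx]; field_simp; ring
  have hyK : ∀ t, t₀ ≤ t → K ≤ y t := by
    intro t ht
    obtain ⟨-, -, h3⟩ := hscale t ht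
    refine le_of_mul_le_mul_left ?_ hmR
    rw [hmy]
    have : 0 ≤ (t : ℝ) * (δ / 2) := by positivity
    linarith
  have key := ae_finite_slab hμ.doubling θ (ι := ℕ) (fun _ => Finset.univ) (fun t _ => ρ t)
    (fun t _ => ρ t / κ t) (fun t => {q | t₀ ≤ t ∧ ‖fun i => (q i : ℝ)‖ ^ n ≤ 2 ^ t})
    (fun t => ENNReal.ofReal (C * κ t ^ α)) ?_ ?_ ?_ ?_
  · filter_upwards [key] with X hX happ
    obtain ⟨N, hN⟩ := hX.bddAbove
    obtain ⟨Q, hQ, hQ1, q, hq0, hd, hq⟩ := happ (2 ^ (max N t₀))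
    obtain ⟨t, ht, hQt, hQt'⟩ := exists_dyadic _ hQ
    refine absurd (hN ⟨q, ⟨(le_max_right _ _).trans ht.le, hq.trans hQt'.le⟩, hq0,
      fun j => -round (affineForm X q θ j), ?_⟩)
      (not_le.2 (lt_of_le_of_lt (le_max_left _ _) ht))
    have hlt : distInt (affineForm X q θ) < ρ t := by
      refine lt_of_pow_lt_pow_left₀ m (by positivity) (hd.trans_le ?_)
      have h1 : ρ t ^ m = (2 ^ ((t : ℝ) - 1)) ^ (-((1 + δ : ℝ≥0) : ℝ)) := by
        simp only [hρ]
        rw [← Real.rpow_natCast, ← Real.rpow_mul zero_le_two, ← Real.rpow_mul zero_le_two]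
        congr 1
        push_cast
        field_simp
      rw [h1]
      exact Real.rpow_le_rpow_of_nonpos (by positivity) hQt (neg_nonpos.2 (NNReal.coe_nonneg _))
    intro j _
    refine lt_of_le_of_lt ?_ hlt
    have h2 := norm_le_pi_norm
      (fun j => affineForm X q θ j - (round (affineForm X q θ j) : ℝ)) j
    rw [Real.norm_eq_abs] at h2
    push_cast
    rw [← sub_eq_add_neg]
    exact h2
  · refine Summable.tsum_ofReal_ne_top ?_
    refine Summable.mul_left C ?_
    simp only [hκ, two_rpow_neg_rpow]
    refine summable_geometric_of_lt_one (by positivity) ?_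
    exact Real.rpow_lt_one_of_one_lt_of_neg one_lt_two (by
      have := mul_pos hxpos hα; linarith)
  · rintro t j - ⟨q, ht, -⟩
    rw [hρκ]
    calc (2 : ℝ) * 2 ^ (-y t) = 2 ^ (1 - y t) := by
          rw [sub_eq_add_neg, Real.rpow_add two_pos, Real.rpow_one]
      _ ≤ 1 := Real.rpow_le_one_of_one_le_of_nonpos one_le_two (by linarith [hyK t ht])
  · rintro t q ⟨ht, -⟩ hq p
    obtain ⟨h1, h2, h3⟩ := hscale t ht
    refine hslab q p θ (ρ t) (κ t) hq (by positivity) (by positivity) ?_ ?_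
    · refine Real.rpow_lt_one_of_one_lt_of_neg one_lt_two ?_
      have : (0 : ℝ) < t := by exact_mod_cast h1
      have := mul_pos this hxpos
      linarith
    · rw [hρκ]
      refine lt_of_le_of_lt (Real.rpow_le_rpow_of_exponent_le one_le_two ?_) hKr
      linarith [hyK t ht]
  · filter_upwards [hext] with X hX
    obtain ⟨Q₁, hQ₁⟩ := exists_forall_le_of_exponent_le hX (show (0 : ℝ) < δ / 4 by positivity)
    refine (finite_setOf_two_pow_le Q₁ n).subset ?_
    rintro t ⟨q, ⟨ht, hq⟩, q', ⟨-, hq'⟩, hne, p, hp⟩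
    obtain ⟨h1, h2, h3⟩ := hscale t ht
    by_contra hlt
    rw [Set.mem_ofPred_eq, not_le] at hlt
    have hb := hQ₁ (2 ^ (t + n)) hlt (one_lt_pow₀ one_lt_two (by omega)) (q - q')
      (sub_ne_zero.2 hne) ?_
    · have hdist : distInt (affineForm X (q - q') 0) ^ m < (2 * (ρ t / κ t)) ^ m :=
        pow_lt_pow_left₀ (distInt_lt_of_forall (by positivity) p fun j => hp j (Finset.mem_univ j))
          (distInt_nonneg _) hm.ne'
      have e1 : (2 * (ρ t / κ t)) ^ m = 2 ^ (m - m * y t) := by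
        rw [hρκ, mul_pow, ← Real.rpow_natCast, ← Real.rpow_natCast, ← Real.rpow_mul zero_le_two,
          ← Real.rpow_add two_pos]
        congr 1; ring
      have e2 : ((2 : ℝ) ^ (t + n)) ^ (-(1 + (δ : ℝ) / 4)) =
          2 ^ (-((t + n) * (1 + (δ : ℝ) / 4))) := by
        rw [← Real.rpow_natCast, ← Real.rpow_mul zero_le_two]
        congr 1; push_cast; ring
      rw [e1] at hdist
      rw [e2] at hb
      have := (Real.rpow_lt_rpow_left_iff one_lt_two).1 (hb.trans_lt hdist)
      rw [hmy] at this
      have hn0 : 0 ≤ (n : ℝ) * (1 + (δ : ℝ) / 4) := by positivity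
      nlinarith
    · have hsub : ‖fun i => (((q - q') i : ℤ) : ℝ)‖ ≤
          2 * max ‖fun i => (q i : ℝ)‖ ‖fun i => (q' i : ℝ)‖ := by
        have e : (fun i => (((q - q') i : ℤ) : ℝ)) =
            (fun i => (q i : ℝ)) - fun i => (q' i : ℝ) := by
          ext i; simp
        rw [e]
        refine (norm_sub_le _ _).trans ?_
        linarith [le_max_left ‖fun i => (q i : ℝ)‖ ‖fun i => (q' i : ℝ)‖,
          le_max_right ‖fun i => (q i : ℝ)‖ ‖fun i => (q' i : ℝ)‖]
      refine (pow_le_pow_left₀ (norm_nonneg _) hsub n).trans ?_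
      rw [mul_pow, pow_add, mul_comm]
      gcongr
      rcases max_choice ‖fun i => (q i : ℝ)‖ ‖fun i => (q' i : ℝ)‖ with h | h <;> rw [h]
      · exact hq
      · exact hq'

end UpperBound

/-! ### Upper bound for the multiplicative exponent, and passage from local to global. -/

section MulUpperBound

variable {m n : ℕ}

/-- Dyadic localisation of numbers in `[0, 1]` with small product. -/
lemma exists_dyadic_bounds (y : Fin m → ℝ) (hy1 : ∀ j, y j ≤ 1) (T : ℕ) {P : ℝ}
    (hPT : P ≤ T) (hprod : ∏ j, y j < 2 ^ (-P)) :
    ∃ s : Fin m → Fin (T + 1), (∀ j, y j < 2 ^ (1 - ((s j : ℕ) : ℝ))) ∧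
      P ≤ ∑ j, ((s j : ℕ) : ℝ) := by
  classical
  set s : Fin m → ℕ := fun j => Nat.findGreatest (fun k => y j < 2 ^ (1 - (k : ℝ))) T with hs
  have hsle : ∀ j, s j ≤ T := fun j => Nat.findGreatest_le T
  refine ⟨fun j => ⟨s j, Nat.lt_succ_of_le (hsle j)⟩, fun j => ?_, ?_⟩
  · exact Nat.findGreatest_spec (P := fun k : ℕ => y j < 2 ^ (1 - (k : ℝ))) (Nat.zero_le T)
      (by simpa using (hy1 j).trans_lt one_lt_two)
  · show P ≤ ∑ j, ((s j : ℕ) : ℝ)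
    -- The cap `T` deals with very small or vanishing `y j`: a single capped index already
    -- contributes `T ≥ P`. Without capped indices, maximality gives `2 ^ (-s j) ≤ y j` for all `j`.
    by_cases hcap : ∃ j, s j = T
    · obtain ⟨j, hj⟩ := hcap
      calc P ≤ (s j : ℝ) := by rw [hj]; exact hPT
        _ ≤ _ := Finset.single_le_sum (f := fun j => (s j : ℝ)) (fun _ _ => Nat.cast_nonneg _)
          (Finset.mem_univ j)
    · push Not at hcap
      have hlow : ∀ j, (2 : ℝ) ^ (-(s j : ℝ)) ≤ y j := by
        intro j
        by_contra! hlt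
        have h1 : s j + 1 ≤ s j :=
          Nat.le_findGreatest (P := fun k : ℕ => y j < 2 ^ (1 - (k : ℝ)))
            (lt_of_le_of_ne (hsle j) (hcap j)) (by
              refine hlt.trans_eq ?_
              congr 1; push_cast; ring)
        omega
      have h2 : (2 : ℝ) ^ (-∑ j, (s j : ℝ)) < 2 ^ (-P) := by
        refine lt_of_le_of_lt ?_ hprod
        rw [← Finset.sum_neg_distrib, Real.rpow_sum_of_pos two_pos]
        exact Finset.prod_le_prod (fun _ _ => by positivity) fun j _ => hlow j
      have := (Real.rpow_lt_rpow_left_iff one_lt_two).1 h2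
      linarith

/-- Dyadic localisation of integer vectors with bounded product. -/
lemma exists_dyadic_box (q : Fin n → ℤ) {t : ℕ} (hq : prodPlus q < 2 ^ t) :
    ∃ u : Fin n → Fin (t + 1), (∀ i, |(q i : ℝ)| < 2 ^ ((u i : ℕ) + 1)) ∧
      ∑ i, (u i : ℕ) ≤ t := by
  -- For `q i = 0` the logarithm is `0` by convention, which matches the factor `max 1 |q i| = 1`.
  set u : Fin n → ℕ := fun i => Nat.log 2 (q i).natAbs with hu
  have habs : ∀ i, |(q i : ℝ)| = ((q i).natAbs : ℝ) := fun i => by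
    rw [Nat.cast_natAbs, Int.cast_abs]
  have h1 : (2 : ℝ) ^ ∑ i, u i < 2 ^ t := by
    refine lt_of_le_of_lt ?_ hq
    rw [← Finset.prod_pow_eq_pow_sum]
    refine Finset.prod_le_prod (fun _ _ => by positivity) fun i _ => ?_
    by_cases h0 : (q i).natAbs = 0
    · simp [hu, h0]
    · refine le_max_of_le_right ?_
      rw [habs]
      exact_mod_cast Nat.pow_log_le_self 2 h0
  have h2 := ((pow_lt_pow_iff_right₀ (one_lt_two (α := ℝ))).1 h1).le
  refine ⟨fun i => ⟨u i, Nat.lt_succ_of_le ((Finset.single_le_sum (f := u)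
    (fun _ _ => Nat.zero_le _) (Finset.mem_univ i)).trans h2)⟩, fun i => ?_, h2⟩
  rw [habs]
  exact_mod_cast Nat.lt_pow_succ_log_self one_lt_two _

lemma prodPlus_sub_le {q q' : Fin n → ℤ} {u : Fin n → ℕ} {t : ℕ}
    (hq : ∀ i, |(q i : ℝ)| < 2 ^ (u i + 1)) (hq' : ∀ i, |(q' i : ℝ)| < 2 ^ (u i + 1))
    (hu : ∑ i, u i ≤ t) : prodPlus (q - q') ≤ 2 ^ (t + 2 * n) :=
  calc prodPlus (q - q') ≤ ∏ i, (2 : ℝ) ^ (u i + 2) := by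
        refine Finset.prod_le_prod (fun _ _ => by positivity) fun i _ => max_le ?_ ?_
        · exact one_le_pow₀ one_le_two
        · rw [Pi.sub_apply, Int.cast_sub]
          refine (abs_sub _ _).trans ?_
          have : (2 : ℝ) ^ (u i + 2) = 2 ^ (u i + 1) + 2 ^ (u i + 1) := by ring
          rw [this]
          exact add_le_add (hq i).le (hq' i).le
    _ ≤ _ := by
        rw [Finset.prod_pow_eq_pow_sum]
        refine pow_le_pow_right₀ one_le_two ?_
        simp only [Finset.sum_add_distrib, Finset.sum_const, Finset.card_univ, Fintype.card_fin,
          smul_eq_mul]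
        omega

/-- The index set of dyadic boxes at all scales. -/
abbrev DyadicIndex (m n : ℕ) : Type :=
  (t : ℕ) × ((Fin m → Fin (2 * t + 1)) × (Fin n → Fin (t + 1)))

/-- The number of dyadic boxes at scale `t` is polynomial in `t`, while the contraction rate decays
geometrically. -/
lemma summable_dyadic_count (m n : ℕ) (C : ℝ) {r : ℝ} (hr0 : 0 < r) (hr1 : r < 1) :
    Summable fun t : ℕ => ((2 * (t : ℝ) + 1) ^ m * ((t : ℝ) + 1) ^ n) * (|C| * r ^ t) := by
  have h0 : Summable fun t : ℕ => (t : ℝ) ^ (m + n) * r ^ t :=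
    summable_pow_mul_geometric_of_norm_lt_one (m + n)
      (show ‖r‖ < 1 by rwa [Real.norm_of_nonneg hr0.le])
  have h1 : Summable fun t : ℕ =>
      2 ^ m * |C| * r⁻¹ * (((t + 1 : ℕ) : ℝ) ^ (m + n) * r ^ (t + 1)) :=
    ((summable_nat_add_iff 1).2 h0).mul_left _
  refine Summable.of_nonneg_of_le (fun t => by positivity) (fun t => ?_) h1
  calc ((2 * (t : ℝ) + 1) ^ m * ((t : ℝ) + 1) ^ n) * (|C| * r ^ t)
      ≤ ((2 * ((t : ℝ) + 1)) ^ m * ((t : ℝ) + 1) ^ n) * (|C| * r ^ t) := by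
        gcongr; linarith
    _ = _ := by
        push_cast
        rw [mul_pow, pow_add, pow_succ r t]
        field_simp

lemma tsum_dyadicIndex_ne_top (m n : ℕ) (C : ℝ) {r : ℝ} (hr0 : 0 < r) (hr1 : r < 1) :
    ∑' i : DyadicIndex m n, ENNReal.ofReal (C * r ^ i.1) ≠ ∞ := by
  rw [ENNReal.tsum_sigma']
  refine ne_top_of_le_ne_top
    (summable_dyadic_count m n C hr0 hr1).tsum_ofReal_ne_top (ENNReal.tsum_le_tsum fun t => ?_)
  dsimp only
  rw [tsum_fintype, Finset.sum_const, Finset.card_univ, nsmul_eq_mul, ← ENNReal.ofReal_natCast,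
    ← ENNReal.ofReal_mul (by positivity)]
  refine ENNReal.ofReal_le_ofReal ?_
  simp only [Fintype.card_prod, Fintype.card_fun, Fintype.card_fin]
  push_cast
  gcongr
  exact le_abs_self C

lemma finite_dyadicIndex {s : Set ℕ} (hs : s.Finite) : {i : DyadicIndex m n | i.1 ∈ s}.Finite := by
  have : {i : DyadicIndex m n | i.1 ∈ s} =
      ⋃ t ∈ s, Set.range (fun z => (⟨t, z⟩ : DyadicIndex m n)) := by
    ext ⟨t, z⟩
    simp only [Set.mem_ofPred_eq, Set.mem_iUnion, Set.mem_range, exists_prop]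
    constructor
    · exact fun h => ⟨t, h, z, rfl⟩
    · rintro ⟨t', h, z', hz⟩
      rw [← (Sigma.mk.inj_iff.1 hz).1]; exact h
  rw [this]
  exact hs.biUnion fun t _ => Set.finite_range _

theorem StronglyContracting.ae_not_mulApproximable (hm : 0 < m) {μ : Measure (MatSpace m n)}
    (hμ : StronglyContracting μ) (hext : ∀ᵐ X ∂μ, mulExponent X 0 ≤ 1) (θ : Fin m → ℝ) {δ : ℝ≥0}
    (hδ0 : 0 < δ) (hδ1 : δ ≤ 1) : ∀ᵐ X ∂μ, ¬ MulApproximable X θ (1 + δ) := by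
  classical
  have := hμ.finite
  have hδ : (0 : ℝ) < δ := hδ0
  have hδ1' : (δ : ℝ) ≤ 1 := hδ1
  have hmR : (0 : ℝ) < m := by exact_mod_cast hm
  obtain ⟨C, α, r₀, hC, hα, hr₀, hslab⟩ := hμ.exists_slab_contracts
  obtain ⟨K, t₀, hK3, hKr, hscale⟩ := exists_scale m n hδ hr₀
  have hK3' : (3 : ℝ) ≤ K := by exact_mod_cast hK3
  set x : ℝ := δ / (2 * m) with hx
  have hxpos : 0 < x := by positivity
  have hmx : m * x = δ / 2 := by rw [hx]; field_simp
  set ρ : DyadicIndex m n → Fin m → ℝ := fun i j => 2 ^ (1 - ((i.2.1 j : ℕ) : ℝ)) with hρ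
  set κ : DyadicIndex m n → ℝ := fun i => 2 ^ (-((i.1 : ℝ) * x)) with hκ
  set V : DyadicIndex m n → Set (Fin n → ℤ) := fun i => {q | t₀ ≤ i.1 ∧
    ((i.1 : ℝ) - 1) * (1 + δ) ≤ ∑ j, ((i.2.1 j : ℕ) : ℝ) ∧ ∑ l, (i.2.2 l : ℕ) ≤ i.1 ∧
    ∀ l, |(q l : ℝ)| < 2 ^ ((i.2.2 l : ℕ) + 1)} with hV
  -- Only rows whose thick slabs are narrower than the integer spacing are kept; in a wider row,
  -- slabs with the same `q` and different `p` could overlap for trivial reasons.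
  set J : DyadicIndex m n → Finset (Fin m) := fun i =>
    Finset.univ.filter fun j => 2 * (ρ i j / κ i) ≤ 1 with hJ
  have hρκ : ∀ i j, ρ i j / κ i = 2 ^ (1 - ((i.2.1 j : ℕ) : ℝ) + i.1 * x) := by
    intro i j
    simp only [hρ, hκ]
    rw [← Real.rpow_sub two_pos]
    congr 1; ring
  have htwo : ∀ z : ℝ, (2 : ℝ) * 2 ^ z = 2 ^ (1 + z) := fun z => by
    rw [Real.rpow_add two_pos, Real.rpow_one]
  have hκ1 : ∀ i, t₀ ≤ i.1 → κ i < 1 := by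
    intro i ht
    refine Real.rpow_lt_one_of_one_lt_of_neg one_lt_two ?_
    have : (0 : ℝ) < i.1 := by exact_mod_cast (hscale i.1 ht).1
    have := mul_pos this hxpos
    linarith
  have key := ae_finite_slab hμ.doubling θ J ρ (fun i j => ρ i j / κ i) V
    (fun i => ENNReal.ofReal (C * κ i ^ α)) ?_ ?_ ?_ ?_
  · filter_upwards [key] with X hX happ
    obtain ⟨N, hN⟩ := (hX.image fun i => i.1).bddAbove
    obtain ⟨Q, hQ, hQ1, q, hq0, hd, hq⟩ := happ (2 ^ (max N t₀))
    obtain ⟨t, ht, hQt, hQt'⟩ := exists_dyadic _ hQ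
    have ht₀ : t₀ ≤ t := (le_max_right _ _).trans ht.le
    have ht1 : (1 : ℝ) ≤ t := by exact_mod_cast (hscale t ht₀).1
    have hprod : prodDistInt (affineForm X q θ) < 2 ^ (-(((t : ℝ) - 1) * (1 + δ))) := by
      refine hd.trans_le ?_
      rw [← mul_neg, Real.rpow_mul zero_le_two]
      have := Real.rpow_le_rpow_of_nonpos (by positivity) hQt
        (neg_nonpos.2 (NNReal.coe_nonneg (1 + δ)))
      simpa only [NNReal.coe_add, NNReal.coe_one] using this
    -- The cap `2 * t` suffices because `δ ≤ 1`.
    obtain ⟨s, hs, hs'⟩ := exists_dyadic_bounds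
      (fun j => |affineForm X q θ j - (round (affineForm X q θ j) : ℝ)|)
      (fun j => (abs_sub_round _).trans (by norm_num)) (2 * t) (P := ((t : ℝ) - 1) * (1 + δ))
      (by push_cast; nlinarith) hprod
    obtain ⟨u, hu, hu'⟩ := exists_dyadic_box q (hq.trans_lt hQt')
    refine absurd (hN ⟨⟨t, s, u⟩, ⟨q, ⟨ht₀, hs', hu', hu⟩, hq0,
      fun j => -round (affineForm X q θ j), fun j _ => ?_⟩, rfl⟩)
      (not_le.2 (lt_of_le_of_lt (le_max_left _ _) ht))
    push_cast
    rw [← sub_eq_add_neg]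
    exact hs j
  · simp only [hκ, two_rpow_neg_rpow]
    refine tsum_dyadicIndex_ne_top m n C (by positivity) ?_
    exact Real.rpow_lt_one_of_one_lt_of_neg one_lt_two (by
      have := mul_pos hxpos hα; linarith)
  · exact fun i j hj _ => (Finset.mem_filter.1 hj).2
  · rintro i q ⟨ht, hs, -, -⟩ hq p
    obtain ⟨h1, h2, h3⟩ := hscale i.1 ht
    refine hslab (J i) q p θ (ρ i) (κ i) hq (fun j => by positivity) (by positivity)
      (hκ1 i ht) ?_
    -- By pigeonhole some row carries at least the average share of the exponent. It therefore
    -- belongs to `J` and has thick width below `r₀`.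
    obtain ⟨j, -, hj⟩ : ∃ j ∈ (Finset.univ : Finset (Fin m)),
        ((i.1 : ℝ) - 1) * (1 + δ) / m ≤ ((i.2.1 j : ℕ) : ℝ) := by
      refine Finset.exists_le_of_sum_le ⟨⟨0, hm⟩, Finset.mem_univ _⟩ (le_trans (le_of_eq ?_) hs)
      simp only [Finset.sum_const, Finset.card_univ, Fintype.card_fin, nsmul_eq_mul]
      field_simp
    have hKj : 1 - ((i.2.1 j : ℕ) : ℝ) + i.1 * x ≤ 1 - K := by
      have h4 : (i.1 : ℝ) * x + K ≤ ((i.1 : ℝ) - 1) * (1 + δ) / m := by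
        rw [le_div_iff₀ hmR]
        have e : ((i.1 : ℝ) * x + K) * m = i.1 * (δ / 2) + m * K := by rw [← hmx]; ring
        rw [e]
        have : 0 ≤ (i.1 : ℝ) * (δ / 2) := by positivity
        linarith
      linarith
    refine ⟨j, ?_, ?_⟩
    · rw [hJ]
      refine Finset.mem_filter.2 ⟨Finset.mem_univ _, ?_⟩
      rw [hρκ, htwo]
      exact Real.rpow_le_one_of_one_le_of_nonpos one_le_two (by linarith)
    · rw [hρκ]
      exact lt_of_le_of_lt (Real.rpow_le_rpow_of_exponent_le one_le_two (by linarith)) hKr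
  · filter_upwards [hext] with X hX
    obtain ⟨Q₁, hQ₁⟩ := exists_forall_le_of_mulExponent_le hX (show (0 : ℝ) < δ / 4 by positivity)
    refine (finite_dyadicIndex (finite_setOf_two_pow_le Q₁ (2 * n))).subset ?_
    rintro i ⟨q, ⟨ht, hs, hu, hq⟩, q', ⟨-, -, -, hq'⟩, hne, p, hp⟩
    obtain ⟨h1, h2, h3⟩ := hscale i.1 ht
    by_contra hlt
    rw [Set.mem_ofPred_eq, Set.mem_ofPred_eq, not_le] at hlt
    have hb := hQ₁ (2 ^ (i.1 + 2 * n)) hlt (one_lt_pow₀ one_lt_two (by omega)) (q - q')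
      (sub_ne_zero.2 hne) (prodPlus_sub_le hq hq' hu)
    have hdist : prodDistInt (affineForm X (q - q') 0) ≤
        2 ^ (2 * m - ∑ j, ((i.2.1 j : ℕ) : ℝ) + i.1 * (δ / 2)) := by
      have e : (2 * m - ∑ j, ((i.2.1 j : ℕ) : ℝ) + i.1 * (δ / 2) : ℝ) =
          ∑ j : Fin m, (1 + (1 - ((i.2.1 j : ℕ) : ℝ) + i.1 * x)) := by
        simp only [Finset.sum_add_distrib, Finset.sum_sub_distrib, Finset.sum_const,
          Finset.card_univ, Fintype.card_fin, nsmul_eq_mul]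
        rw [← hmx]; ring
      rw [e, Real.rpow_sum_of_pos two_pos]
      refine Finset.prod_le_prod (fun _ _ => abs_nonneg _) fun j _ => ?_
      rw [← htwo, ← hρκ]
      -- A discarded row satisfies the bound for free: the distance to the nearest integer is at
      -- most `1 / 2`, and `2 * (ρ i j / κ i) > 1`. Dropping rows thus loses nothing in the product.
      by_cases hj : j ∈ J i
      · have h4 := round_le (affineForm X (q - q') 0 j) (-p j)
        push_cast at h4
        rw [sub_neg_eq_add] at h4
        exact h4.trans (hp j hj).le
      · have h4 : ¬ 2 * (ρ i j / κ i) ≤ 1 := fun h =>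
          hj (Finset.mem_filter.2 ⟨Finset.mem_univ _, h⟩)
        exact (abs_sub_round _).trans (by linarith [not_le.1 h4])
    have e2 : ((2 : ℝ) ^ (i.1 + 2 * n)) ^ (-(1 + (δ : ℝ) / 4)) =
        2 ^ (-((i.1 + 2 * n) * (1 + (δ : ℝ) / 4))) := by
      rw [← Real.rpow_natCast, ← Real.rpow_mul zero_le_two]
      congr 1; push_cast; ring
    rw [e2] at hb
    have := (Real.rpow_le_rpow_left_iff one_lt_two).1 (hb.trans hdist)
    nlinarith

/-- A property that holds almost everywhere locally holds almost everywhere. -/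
lemma ae_of_ae_restrict_nhds {μ : Measure (MatSpace m n)} {p : MatSpace m n → Prop}
    (h : ∀ᵐ X₀ ∂μ, ∃ U ∈ 𝓝 X₀, ∀ᵐ X ∂μ.restrict U, p X) : ∀ᵐ X ∂μ, p X := by
  set G := {X₀ | ∃ U ∈ 𝓝 X₀, ∀ᵐ X ∂μ.restrict U, p X} with hG
  have hnull : μ ({X | ¬ p X} ∩ G) = 0 := by
    refine measure_null_of_locally_null _ fun X₀ hX₀ => ?_
    obtain ⟨U, hU, hp⟩ := hX₀.2
    refine ⟨{X | ¬ p X} ∩ interior U, ?_, ?_⟩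
    · exact mem_nhdsWithin.2 ⟨interior U, isOpen_interior, mem_interior_iff_mem_nhds.2 hU,
        fun X hX => ⟨hX.2.1, hX.1⟩⟩
    · rw [← Measure.restrict_apply' isOpen_interior.measurableSet]
      exact le_antisymm ((Measure.restrict_mono_set μ interior_subset _).trans_eq hp) bot_le
  have hnull' : ∀ᵐ X ∂μ, ¬ (¬ p X ∧ X ∈ G) := measure_eq_zero_iff_ae_notMem.1 hnull
  filter_upwards [h, hnull'] with X hX hX'
  by_contra hcon
  exact hX' ⟨hcon, hX⟩

end MulUpperBound

/-! ### Assembly of the upper and lower bounds. -/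

theorem inhomExtremal_of_extremal {m n : ℕ} (hm : 0 < m) (hn : 0 < n)
    {μ : Measure (MatSpace m n)} (hμ : ContractingAE μ) (h : Extremal μ) : InhomExtremal μ := by
  intro θ
  have hupper : ∀ᵐ X ∂μ, exponent X θ ≤ 1 := by
    refine ae_of_ae_restrict_nhds ?_
    filter_upwards [hμ] with X₀ ⟨U, hU, hc⟩
    refine ⟨U, hU, ?_⟩
    have := ae_all_iff.2 fun k : ℕ => hc.ae_not_approximable hm
      ((ae_restrict_of_ae h).mono fun X hX => hX.le) θ
      (show (0 : ℝ≥0) < 1 / ((k : ℝ≥0) + 1) by positivity)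
    exact this.mono fun X hX => exponent_le_one hX
  filter_upwards [hupper, h] with X h1 h2
  exact le_antisymm h1 (one_le_exponent hm hn h2.le θ)

theorem inhomStronglyExtremal_of_stronglyExtremal {m n : ℕ} (hm : 0 < m) (hn : 0 < n)
    {μ : Measure (MatSpace m n)} (hμ : StronglyContractingAE μ) (h : StronglyExtremal μ) :
    InhomStronglyExtremal μ := by
  intro θ
  have hupper : ∀ᵐ X ∂μ, mulExponent X θ ≤ 1 := by
    refine ae_of_ae_restrict_nhds ?_
    filter_upwards [hμ] with X₀ ⟨U, hU, hc⟩
    refine ⟨U, hU, ?_⟩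
    have := ae_all_iff.2 fun k : ℕ => hc.ae_not_mulApproximable hm
      ((ae_restrict_of_ae h).mono fun X hX => hX.le) θ
      (show (0 : ℝ≥0) < 1 / ((k : ℝ≥0) + 1) by positivity)
      (div_le_one_of_le₀ (by simp) (by positivity))
    exact this.mono fun X hX => mulExponent_le_one hX
  filter_upwards [hupper, h] with X h1 h2
  -- The chain is `w(X, 0) ≤ w*(X, 0) ≤ 1`, hence `1 ≤ w(X, θ) ≤ w*(X, θ)`; no separate
  -- multiplicative lower bound is needed.
  exact le_antisymm h1 ((one_le_exponent hm hn
    ((exponent_le_mulExponent X 0).trans h2.le) θ).trans (exponent_le_mulExponent X θ))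

end InhomDioph

theorem theorem1 (m n : ℕ) (hm : 0 < m) (hn : 0 < n)
    (μ : MeasureTheory.Measure (InhomDioph.MatSpace m n)) :
    (InhomDioph.ContractingAE μ →
      (InhomDioph.Extremal μ ↔ InhomDioph.InhomExtremal μ)) ∧
    (InhomDioph.StronglyContractingAE μ →
      (InhomDioph.StronglyExtremal μ ↔ InhomDioph.InhomStronglyExtremal μ)) :=
  ⟨fun hμ => ⟨fun h => InhomDioph.inhomExtremal_of_extremal hm hn hμ h, fun h => h 0⟩,
    fun hμ => ⟨fun h => InhomDioph.inhomStronglyExtremal_of_stronglyExtremal hm hn hμ h,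
      fun h => h 0⟩⟩
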